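/- Let $H$ and $A$ be self-adjoint operators in a complex Hilbert space $\mathcal H$, with $(H-i)^{-1}\in C^1(A)$, that is, for every $\varphi\in\mathcal H$ the map $\mathbb R\ni t\mapsto e^{-itA}(H-i)^{-1}e^{itA}\varphi\in\mathcal H$ is of class $C^1$. Let $[H,A]$ denote the unique extension of the sesquilinear form $(\varphi,\psi)\mapsto\langle H\varphi,A\psi\rangle-\langle A\varphi,H\psi\rangle$ on $\mathrm{dom}(H)\cap\mathrm{dom}(A)$ to a sesquilinear form on $\mathrm{dom}(H)$ that is continuous for the graph topology of $H$ (identified with an operator from $\mathrm{dom}(H)$ to its adjoint space $\mathrm{dom}(H)^*$), and let $[iH,A]:=i[H,A]$; then $(H+i)^{-1}[iH,A](H-i)^{-1}$ is the bounded operator $B$ with $\langle\varphi,B\psi\rangle=i\,[H,A]\big((H-i)^{-1}\varphi,(H-i)^{-1}\psi\big)$ for all $\varphi,\psi\in\mathcal H$. Assume that the strong limit $$D:=\mathop{\mathrm{s\text{-}lim}}_{t\to\infty}\frac1t\int_0^t e^{isH}(H+i)^{-1}[iH,A](H-i)^{-1}e^{-isH}\,ds$$ exists (it is then a bounded self-adjoint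 operator), and suppose that $D^{-1}\eta(D)\,\mathrm{dom}(A)\subset\mathrm{dom}(A)$ for each $\eta\in C^\infty_c(\mathbb R\setminus\{0\})$, where $D^{-1}\eta(D)$ is the operator $f(D)$ of the functional calculus with $f(x)=x^{-1}\eta(x)$ for $x\neq0$ and $f(0)=0$. Then: (a) $\lim_{t\to\infty}\langle\varphi,e^{-itH}\psi\rangle=0$ for each $\varphi\in\mathcal H$ and $\psi\in\ker(D)^\perp$; (b) $\ker(D)^\perp$ reduces $H$, the restriction $H|_{\ker(D)^\perp}$ is a self-adjoint operator in $\ker(D)^\perp$, and it has purely continuous spectrum, that is, the orthogonal complement in $\ker(D)^\perp$ of the closed linear span of its eigenvectors is all of $\ker(D)^\perp$. -/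

import Mathlib

open Filter Topology

namespace CommutatorMixing

variable {E : Type*} [NormedAddCommGroup E] [InnerProductSpace ℂ E] [CompleteSpace E]
  {H A : E →ₗ.[ℂ] E}

theorem mem_graph_iff_forall (hH : IsSelfAdjoint H) {x y : E} :
    (x, y) ∈ H.graph ↔ ∀ a b, (a, b) ∈ H.graph → inner ℂ b x = inner ℂ a y := by
  have h : H.graph = H.graph.adjoint := by
    conv_lhs => rw [← LinearPMap.isSelfAdjoint_def.1 hH]
    exact LinearPMap.adjoint_graph_eq_graph_adjoint hH.dense_domain
  conv_lhs => rw [h]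
  simp [Submodule.mem_adjoint_iff, sub_eq_zero]

theorem graph_symm (hH : IsSelfAdjoint H) {x y a b : E} (h : (x, y) ∈ H.graph)
    (h' : (a, b) ∈ H.graph) : inner ℂ b x = inner ℂ a y :=
  (mem_graph_iff_forall hH).1 h a b h'

theorem norm_le_of_mem_graph (hH : IsSelfAdjoint H) (z : ℂ) {x y : E} (h : (x, y) ∈ H.graph) :
    |z.im| * ‖x‖ ≤ ‖y - z • x‖ := by
  have h1 : (inner ℂ x y).im = 0 := by
    have h2 := graph_symm hH h h
    rw [← inner_conj_symm y x] at h2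
    have := congrArg Complex.im h2
    simp only [Complex.conj_im] at this
    linarith
  have h2 : (inner ℂ x (y - z • x)).im = -(z.im * ‖x‖ ^ 2) := by
    have h3 : inner ℂ x x = ((‖x‖ ^ 2 : ℝ) : ℂ) := by
      rw [inner_self_eq_norm_sq_to_K]; push_cast; rfl
    rw [inner_sub_right, inner_smul_right, h3, Complex.sub_im, h1, Complex.im_mul_ofReal]
    ring
  have h3 : |z.im| * ‖x‖ ^ 2 ≤ ‖x‖ * ‖y - z • x‖ := by
    calc |z.im| * ‖x‖ ^ 2 = |(inner ℂ x (y - z • x)).im| := by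
          rw [h2, abs_neg, abs_mul, abs_of_nonneg (sq_nonneg ‖x‖)]
      _ ≤ ‖inner ℂ x (y - z • x)‖ := Complex.abs_im_le_norm _
      _ ≤ _ := norm_inner_le_norm _ _
  rcases (norm_nonneg x).eq_or_lt with h0 | h0
  · rw [← h0]; simp
  · nlinarith

/-- `R = (H - z)⁻¹`. -/
structure IsResolvent (H : E →ₗ.[ℂ] E) (z : ℂ) (R : E →L[ℂ] E) : Prop where
  graph : ∀ x, (R x, x + z • R x) ∈ H.graph
  left_inv : ∀ x y, (x, y) ∈ H.graph → R (y - z • x) = x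

theorem exists_isResolvent (hH : IsSelfAdjoint H) {z : ℂ} (hz : z.im ≠ 0) :
    ∃ R, IsResolvent H z R := by
  have hpos : 0 < |z.im| := abs_pos.2 hz
  let S : Submodule ℂ E := LinearMap.range (H.toFun - z • H.domain.subtype)
  have hS : ∀ y, y ∈ S ↔ ∃ x, (x, y + z • x) ∈ H.graph := by
    intro y
    constructor
    · rintro ⟨x, rfl⟩
      refine ⟨x, ?_⟩
      simp
    · rintro ⟨x, hx⟩
      obtain ⟨x', hx', hx2⟩ := H.mem_graph_iff.1 hx
      refine ⟨x', ?_⟩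
      simp only [LinearMap.sub_apply, LinearMap.smul_apply, Submodule.subtype_apply]
      change H x' - _ = _
      rw [hx2]
      simp at hx' ⊢
      simp [hx']
  have hclosed : IsClosed (S : Set E) := by
    refine isClosed_of_closure_subset fun y hy => ?_
    obtain ⟨u, hu, hul⟩ := mem_closure_iff_seq_limit.1 hy
    choose v hv using fun n => (hS (u n)).1 (hu n)
    have hd : ∀ n m, |z.im| * ‖v n - v m‖ ≤ ‖u n - u m‖ := by
      intro n m
      have := norm_le_of_mem_graph hH z (H.graph.sub_mem (hv n) (hv m))
      refine this.trans (le_of_eq ?_)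
      congr 1
      simp only [smul_sub]
      abel
    have hc : CauchySeq v := by
      have hcu := hul.cauchySeq
      rw [Metric.cauchySeq_iff] at hcu ⊢
      intro ε hε
      obtain ⟨N, hN⟩ := hcu (|z.im| * ε) (by positivity)
      refine ⟨N, fun m hm n hn => ?_⟩
      have h1 := hN m hm n hn
      rw [dist_eq_norm] at h1 ⊢
      have h2 := hd m n
      exact lt_of_mul_lt_mul_left (h2.trans_lt h1) hpos.le
    obtain ⟨x, hx⟩ := cauchySeq_tendsto_of_complete hc
    refine (hS y).2 ⟨x, ?_⟩
    have hcl : IsClosed (H.graph : Set (E × E)) := hH.isClosed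
    exact hcl.mem_of_tendsto (hx.prodMk_nhds (hul.add (hx.const_smul z)))
      (Eventually.of_forall hv)
  have hperp : Sᗮ = ⊥ := by
    rw [Submodule.eq_bot_iff]
    intro w hw
    have h1 : (w, (starRingEnd ℂ z) • w) ∈ H.graph := by
      rw [mem_graph_iff_forall hH]
      intro a b hab
      have h2 : b - z • a ∈ S := (hS _).2 ⟨a, by simpa using hab⟩
      have h3 := (Submodule.mem_orthogonal S w).1 hw _ h2
      rw [inner_sub_left, inner_smul_left, sub_eq_zero] at h3
      rw [h3, inner_smul_right]
    have h2 := norm_le_of_mem_graph hH (starRingEnd ℂ z) h1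
    simp only [Complex.conj_im, abs_neg, sub_self, norm_zero] at h2
    have h3 : ‖w‖ ≤ 0 := by
      by_contra hcon
      have := mul_pos hpos (not_le.1 hcon)
      linarith
    simpa using h3
  have htop : S = ⊤ := by
    have : S.topologicalClosure = ⊤ := Submodule.topologicalClosure_eq_top_iff.2 hperp
    rwa [IsClosed.submodule_topologicalClosure_eq hclosed] at this
  have hex : ∀ y, ∃ x, (x, y + z • x) ∈ H.graph := fun y => (hS y).1 (htop ▸ Submodule.mem_top)
  have huniq : ∀ x x' y, (x, y + z • x) ∈ H.graph → (x', y + z • x') ∈ H.graph → x = x' := by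
    intro x x' y hx hx'
    have := norm_le_of_mem_graph hH z (H.graph.sub_mem hx hx')
    have h0 : (y + z • x - (y + z • x')) - z • (x - x') = 0 := by
      rw [smul_sub]; abel
    simp only at this
    rw [h0, norm_zero] at this
    have h3 : ‖x - x'‖ ≤ 0 := by
      by_contra hcon
      have := mul_pos hpos (not_le.1 hcon)
      linarith
    exact sub_eq_zero.1 (by simpa using h3)
  choose R hR using hex
  let L : E →ₗ[ℂ] E :=
    { toFun := R
      map_add' := fun x y => huniq _ _ _ (hR _) (by
        have := H.graph.add_mem (hR x) (hR y)
        simp only [Prod.mk_add_mk] at this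
        convert this using 2
        rw [smul_add]; abel)
      map_smul' := fun c x => huniq _ _ _ (hR _) (by
        have := H.graph.smul_mem c (hR x)
        simp only [Prod.smul_mk] at this
        convert this using 2
        · rfl
        change c • x + z • (c • R x) = c • (x + z • R x)
        rw [smul_comm z c, smul_add]) }
  refine ⟨L.mkContinuous |z.im|⁻¹ fun x => ?_, ?_, ?_⟩
  · have := norm_le_of_mem_graph hH z (hR x)
    simp only [add_sub_cancel_right] at this
    change ‖R x‖ ≤ _
    rw [inv_mul_eq_div, le_div_iff₀ hpos]
    linarith
  · exact hR
  · intro x y hxy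
    exact huniq _ _ _ (hR _) (by simpa using hxy)

theorem IsResolvent.unique {z : ℂ} {R R' : E →L[ℂ] E} (h : IsResolvent H z R)
    (h' : IsResolvent H z R') : R = R' := by
  ext x
  have := h'.left_inv _ _ (h.graph x)
  simpa using this.symm

theorem IsResolvent.norm_le (hH : IsSelfAdjoint H) {z : ℂ} {R : E →L[ℂ] E}
    (h : IsResolvent H z R) (x : E) : |z.im| * ‖R x‖ ≤ ‖x‖ := by
  simpa using norm_le_of_mem_graph hH z (h.graph x)

theorem IsResolvent.inner_left (hH : IsSelfAdjoint H) {z : ℂ} {R Q : E →L[ℂ] E}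
    (h : IsResolvent H z R) (h' : IsResolvent H (starRingEnd ℂ z) Q) (x y : E) :
    inner ℂ (R x) y = inner ℂ x (Q y) := by
  have := graph_symm hH (h'.graph y) (h.graph x)
  simp only [inner_add_left, inner_add_right, inner_smul_left, inner_smul_right] at this
  exact (add_right_cancel this).symm

theorem IsResolvent.commute {z w : ℂ} {R Q : E →L[ℂ] E}
    (h : IsResolvent H z R) (h' : IsResolvent H w Q) : Commute R Q := by
  by_cases hzw : z = w
  · subst hzw; rw [h.unique h']
  have key : ∀ {z w : ℂ} {R Q : E →L[ℂ] E}, IsResolvent H z R → IsResolvent H w Q →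
      ∀ x, R x - Q x = (z - w) • R (Q x) := by
    intro z w R Q h h' x
    have h1 := h.left_inv _ _ (h'.graph x)
    simp only [map_add, map_sub, map_smul] at h1
    calc R x - Q x = R x - (R x + w • R (Q x) - z • R (Q x)) := by rw [h1]
      _ = _ := by module
  ext x
  have h1 := key h h' x
  have h2 := key h' h x
  have h3 : (z - w) • (R (Q x) - Q (R x)) = 0 := by
    rw [smul_sub, ← h1, ← neg_sub w z, neg_smul, ← h2]; abel
  have := (smul_eq_zero.1 h3).resolve_left (sub_ne_zero.2 hzw)
  exact sub_eq_zero.1 this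

/-- Bounded self-adjoint commuting approximations of `H`, strongly convergent on `dom H`. -/
theorem exists_approx (hH : IsSelfAdjoint H) :
    ∃ T : ℕ → E →L[ℂ] E, (∀ n, IsSelfAdjoint (T n)) ∧ (∀ n m, Commute (T n) (T m)) ∧
      ∀ x y, (x, y) ∈ H.graph → Tendsto (fun n => T n x) atTop (𝓝 y) := by
  have hz : ∀ n : ℕ, ((((n : ℝ) + 1 : ℝ) : ℂ) * Complex.I).im ≠ 0 := fun n => by
    simp; positivity
  have hz' : ∀ n : ℕ, (starRingEnd ℂ ((((n : ℝ) + 1 : ℝ) : ℂ) * Complex.I)).im ≠ 0 := fun n => by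
    rw [Complex.conj_im]; exact neg_ne_zero.2 (hz n)
  have hzi : ∀ n : ℕ, ((((n : ℝ) + 1 : ℝ) : ℂ) * Complex.I).im = (n : ℝ) + 1 := fun n => by simp
  choose R hR using fun n => exists_isResolvent hH (hz n)
  choose Q hQ using fun n => exists_isResolvent hH (hz' n)
  have hRn : ∀ (n : ℕ) x, ((n : ℝ) + 1) * ‖R n x‖ ≤ ‖x‖ := fun n x => by
    have := (hR n).norm_le hH x
    rwa [hzi, abs_of_pos (by positivity)] at this
  have hQn : ∀ (n : ℕ) x, ((n : ℝ) + 1) * ‖Q n x‖ ≤ ‖x‖ := fun n x => by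
    have := (hQ n).norm_le hH x
    rwa [Complex.conj_im, abs_neg, hzi, abs_of_pos (by positivity)] at this
  have hconj : ∀ n : ℕ, starRingEnd ℂ ((((n : ℝ) + 1 : ℝ) : ℂ) * Complex.I) =
      -((((n : ℝ) + 1 : ℝ) : ℂ) * Complex.I) := fun n => by simp
  have hRg : ∀ n x y, (x, y) ∈ H.graph →
      R n y = x + ((((n : ℝ) + 1 : ℝ) : ℂ) * Complex.I) • R n x := by
    intro n x y h
    have := (hR n).left_inv x y h
    rw [map_sub, map_smul] at this
    exact sub_eq_iff_eq_add.1 this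
  have hQg : ∀ n x y, (x, y) ∈ H.graph →
      Q n y = x - ((((n : ℝ) + 1 : ℝ) : ℂ) * Complex.I) • Q n x := by
    intro n x y h
    have := (hQ n).left_inv x y h
    rw [map_sub, map_smul, hconj, neg_smul, sub_neg_eq_add] at this
    exact eq_sub_iff_add_eq.2 this
  let J : ℕ → E →L[ℂ] E := fun n =>
    (((((n : ℝ) + 1 : ℝ) : ℂ) * Complex.I) / 2) • (Q n - R n)
  have hJn : ∀ n x, ‖J n x‖ ≤ ‖x‖ := by
    intro n x
    have h1 : ‖(((((n : ℝ) + 1 : ℝ) : ℂ) * Complex.I) / 2)‖ = ((n : ℝ) + 1) / 2 := by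
      rw [norm_div, norm_mul, Complex.norm_I, Complex.norm_real, Real.norm_of_nonneg (by positivity)]
      simp
    change ‖(((((n : ℝ) + 1 : ℝ) : ℂ) * Complex.I) / 2) • (Q n x - R n x)‖ ≤ _
    rw [norm_smul, h1]
    have h2 := norm_sub_le (Q n x) (R n x)
    have h3 := hRn n x
    have h4 := hQn n x
    have h5 : (0 : ℝ) ≤ (n : ℝ) + 1 := by positivity
    nlinarith
  have hJg : ∀ x y, (x, y) ∈ H.graph → Tendsto (fun n => J n x) atTop (𝓝 x) := by
    intro x y h
    rw [tendsto_iff_norm_sub_tendsto_zero]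
    have hlim : Tendsto (fun n : ℕ => ‖y‖ * (1 / ((n : ℝ) + 1))) atTop (𝓝 0) := by
      simpa using (tendsto_one_div_add_atTop_nhds_zero_nat (𝕜 := ℝ)).const_mul ‖y‖
    refine squeeze_zero (fun _ => norm_nonneg _) (fun n => ?_) hlim
    have h1 : J n x - x = -((1 / 2 : ℂ) • (Q n y + R n y)) := by
      rw [hRg n x y h, hQg n x y h]
      change (((((n : ℝ) + 1 : ℝ) : ℂ) * Complex.I) / 2) • (Q n x - R n x) - x = _
      module
    have h3 := hRn n y
    have h4 := hQn n y
    have h5 : (0 : ℝ) < (n : ℝ) + 1 := by positivity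
    rw [h1, norm_neg, norm_smul, mul_one_div, le_div_iff₀ h5]
    have h2 := norm_add_le (Q n y) (R n y)
    have h6 : ‖(1 / 2 : ℂ)‖ = 1 / 2 := by simp
    rw [h6]
    nlinarith
  have hJ : ∀ y, Tendsto (fun n => J n y) atTop (𝓝 y) := by
    intro y
    rw [Metric.tendsto_atTop]
    intro ε hε
    obtain ⟨x, hx, hxy⟩ := Metric.dense_iff.1 hH.dense_domain y (ε / 3) (by positivity)
    obtain ⟨N, hN⟩ := Metric.tendsto_atTop.1 (hJg _ _ (H.mem_graph ⟨x, hxy⟩)) (ε / 3) (by positivity)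
    refine ⟨N, fun n hn => ?_⟩
    have h1 := hN n hn
    have h2 : dist (J n y) (J n x) ≤ dist y x := by
      rw [dist_eq_norm, dist_eq_norm, ← map_sub]; exact hJn n _
    have h3 : dist x y < ε / 3 := hx
    have h4 := dist_triangle4 (J n y) (J n x) x y
    rw [dist_comm y x] at h2
    simp only at h1
    linarith
  refine ⟨fun n => (((((n : ℝ) + 1 : ℝ) : ℂ)) ^ 2 / 2) • (R n + Q n), fun n => ?_, fun n m => ?_, ?_⟩
  · rw [ContinuousLinearMap.isSelfAdjoint_iff_isSymmetric]
    intro x y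
    have h1 := (hR n).inner_left hH (hQ n)
    have h2 : ∀ x y, inner ℂ (Q n x) y = inner ℂ x (R n y) := fun x y => by
      rw [← inner_conj_symm, ← h1, inner_conj_symm]
    have h3 : starRingEnd ℂ ((((n : ℝ) + 1 : ℝ) : ℂ) ^ 2 / 2) = (((n : ℝ) + 1 : ℝ) : ℂ) ^ 2 / 2 := by
      rw [map_div₀, map_pow, Complex.conj_ofReal, map_ofNat]
    change inner ℂ ((((((n : ℝ) + 1 : ℝ) : ℂ)) ^ 2 / 2) • (R n x + Q n x)) y =
      inner ℂ x ((((((n : ℝ) + 1 : ℝ) : ℂ)) ^ 2 / 2) • (R n y + Q n y))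
    rw [inner_smul_left, inner_smul_right, h3, inner_add_left, inner_add_right, h1, h2,
      add_comm (inner ℂ x (Q n y))]
  · refine Commute.smul_left (Commute.smul_right ?_ _) _
    exact (((hR n).commute (hR m)).add_left ((hQ n).commute (hR m))).add_right
      (((hR n).commute (hQ m)).add_left ((hQ n).commute (hQ m)))
  · intro x y h
    refine (hJ y).congr fun n => ?_
    change (((((n : ℝ) + 1 : ℝ) : ℂ) * Complex.I) / 2) • (Q n y - R n y) =
      (((((n : ℝ) + 1 : ℝ) : ℂ)) ^ 2 / 2) • (R n x + Q n x)
    rw [hRg n x y h, hQg n x y h]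
    have hI : Complex.I * Complex.I = -1 := Complex.I_mul_I
    match_scalars <;> ring_nf <;> simp [Complex.I_sq] <;> ring

theorem expGroup_aux {T : E →L[ℂ] E} (hT : IsSelfAdjoint T) (t : ℝ) :
    NormedSpace.exp (t • (Complex.I • T)) ∈ unitary (E →L[ℂ] E) := by
  let _ : NormedAlgebra ℚ (E →L[ℂ] E) := .restrictScalars ℚ ℂ _
  apply NormedSpace.exp_mem_unitary_of_mem_skewAdjoint
  rw [skewAdjoint.mem_iff]
  rw [star_smul, star_smul, hT.star_eq]
  simp

theorem expGroup_hasDerivAt (T : E →L[ℂ] E) (t : ℝ) (x : E) :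
    HasDerivAt (fun s : ℝ => NormedSpace.exp (s • (Complex.I • T)) x)
      (NormedSpace.exp (t • (Complex.I • T)) (Complex.I • T x)) t :=
  ((ContinuousLinearMap.apply ℂ E x).restrictScalars ℝ).hasFDerivAt.comp_hasDerivAt t
    (hasDerivAt_exp_smul_const (𝕂 := ℝ) (Complex.I • T) t)

theorem expGroup_sub_le {T S : E →L[ℂ] E} (hT : IsSelfAdjoint T) (hS : IsSelfAdjoint S)
    (hTS : Commute T S) (t : ℝ) (x : E) :
    ‖NormedSpace.exp (t • (Complex.I • T)) x - NormedSpace.exp (t • (Complex.I • S)) x‖ ≤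
      ‖T x - S x‖ * |t| := by
  have hc : ∀ t : ℝ, Commute (t • (Complex.I • S)) (t • (Complex.I • T)) := fun t =>
    ((hTS.symm.smul_left _).smul_right _).smul_left _ |>.smul_right _
  have hadd : ∀ t : ℝ, NormedSpace.exp (t • (Complex.I • T)) =
      NormedSpace.exp (t • (Complex.I • S)) * NormedSpace.exp (t • (Complex.I • (T - S))) := by
    intro t
    let _ : NormedAlgebra ℚ (E →L[ℂ] E) := .restrictScalars ℚ ℂ _
    rw [← NormedSpace.exp_add_of_commute]
    · congr 1
      rw [← smul_add, ← smul_add]; congr 2; abel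
    · have h1 : t • (Complex.I • (T - S)) = t • (Complex.I • T) - t • (Complex.I • S) := by
        rw [smul_sub, smul_sub]
      rw [h1]
      exact (hc t).sub_right (Commute.refl _)
  have h1 : NormedSpace.exp (t • (Complex.I • T)) x - NormedSpace.exp (t • (Complex.I • S)) x =
      NormedSpace.exp (t • (Complex.I • S))
        (NormedSpace.exp (t • (Complex.I • (T - S))) x - x) := by
    rw [hadd, map_sub]; rfl
  rw [h1, ContinuousLinearMap.norm_map_of_mem_unitary (expGroup_aux hS t)]
  have h2 : ∀ s : ℝ, ‖NormedSpace.exp (s • (Complex.I • (T - S))) (Complex.I • (T - S) x)‖ ≤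
      ‖T x - S x‖ := by
    intro s
    rw [ContinuousLinearMap.norm_map_of_mem_unitary (expGroup_aux (hT.sub hS) s), norm_smul,
      Complex.norm_I, one_mul]
    rfl
  have h3 := Convex.norm_image_sub_le_of_norm_hasDerivWithin_le (s := Set.univ) (x := (0 : ℝ)) (y := t)
    (fun s _ => (expGroup_hasDerivAt (T - S) s x).hasDerivWithinAt) (fun s _ => h2 s) convex_univ
    (Set.mem_univ _) (Set.mem_univ _)
  simpa using h3

/-- `U t = exp (i t H)`: the strongly continuous one-parameter unitary group whose generator is
exactly `i H` (domain included). -/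
structure IsUnitaryGroup (H : E →ₗ.[ℂ] E) (U : ℝ → E →L[ℂ] E) : Prop where
  unitary : ∀ t, U t ∈ unitary (E →L[ℂ] E)
  zero : U 0 = 1
  add : ∀ s t, U (s + t) = U s * U t
  continuous : ∀ x, Continuous fun t => U t x
  generator : ∀ x y, (x, y) ∈ H.graph ↔ HasDerivAt (fun t => U t x) (Complex.I • y) 0

theorem exists_isUnitaryGroup (hH : IsSelfAdjoint H) : ∃ U, IsUnitaryGroup H U := by
  obtain ⟨T, hT, hTc, hTl⟩ := exists_approx hH
  obtain ⟨V, hV⟩ : ∃ V : ℕ → ℝ → E →L[ℂ] E,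
      V = fun n t => NormedSpace.exp (t • (Complex.I • T n)) := ⟨_, rfl⟩
  have hVn : ∀ n t x, ‖V n t x‖ = ‖x‖ := fun n t x => by
    rw [hV]; exact ContinuousLinearMap.norm_map_of_mem_unitary (expGroup_aux (hT n) t) x
  have hVd : ∀ n m t x, ‖V n t x - V m t x‖ ≤ ‖T n x - T m x‖ * |t| := fun n m t x => by
    rw [hV]; exact expGroup_sub_le (hT n) (hT m) (hTc n m) t x
  have hV1 : ∀ n t x, ‖V n t x - x‖ ≤ ‖T n x‖ * |t| := fun n t x => by
    have := expGroup_sub_le (hT n) (IsSelfAdjoint.zero _) (Commute.zero_right _) t x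
    rw [hV]; simpa using this
  have hV0 : ∀ n, V n 0 = 1 := fun n => by rw [hV]; simp
  have hVa : ∀ n s t, V n (s + t) = V n s * V n t := fun n s t => by
    let _ : NormedAlgebra ℚ (E →L[ℂ] E) := .restrictScalars ℚ ℂ _
    simp only [hV]
    rw [← NormedSpace.exp_add_of_commute, add_smul]
    exact ((Commute.refl _).smul_left _).smul_right _
  have hVder : ∀ n t x, HasDerivAt (fun s => V n s x) (V n t (Complex.I • T n x)) t :=
    fun n t x => by rw [hV]; exact expGroup_hasDerivAt (T n) t x
  clear hV
  have happ : ∀ (y : E) (ε : ℝ), 0 < ε → ∃ a b, (a, b) ∈ H.graph ∧ ‖y - a‖ < ε := by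
    intro y ε hε
    obtain ⟨a, ha, ha'⟩ := Metric.dense_iff.1 hH.dense_domain y ε hε
    refine ⟨a, H ⟨a, ha'⟩, H.mem_graph ⟨a, ha'⟩, ?_⟩
    rw [← dist_eq_norm, dist_comm]; exact ha
  have hcauchy : ∀ t y, CauchySeq fun n => V n t y := by
    intro t y
    rw [Metric.cauchySeq_iff]
    intro ε hε
    obtain ⟨a, b, hab, ha⟩ := happ y (ε / 4) (by positivity)
    have hc := (hTl a b hab).cauchySeq
    rw [Metric.cauchySeq_iff] at hc
    obtain ⟨N, hN⟩ := hc (ε / (4 * (|t| + 1))) (by positivity)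
    refine ⟨N, fun m hm n hn => ?_⟩
    have h1 := hN m hm n hn
    rw [dist_eq_norm] at h1 ⊢
    have h2 := hVd m n t a
    have h3 : ‖V m t (y - a)‖ < ε / 4 := by rwa [hVn]
    have h4 : ‖V n t (y - a)‖ < ε / 4 := by rwa [hVn]
    have h5 : V m t y - V n t y = V m t (y - a) + (V m t a - V n t a) - V n t (y - a) := by
      simp only [map_sub]; abel
    have h6 : ‖T m a - T n a‖ * |t| ≤ ε / 4 := by
      have : ‖T m a - T n a‖ * (4 * (|t| + 1)) < ε := (lt_div_iff₀ (by positivity)).1 h1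
      have := norm_nonneg (T m a - T n a)
      nlinarith
    rw [h5]
    have h7 := norm_sub_le (V m t (y - a) + (V m t a - V n t a)) (V n t (y - a))
    have h8 := norm_add_le (V m t (y - a)) (V m t a - V n t a)
    linarith
  choose u hu using fun t y => cauchySeq_tendsto_of_complete (hcauchy t y)
  let U : ℝ → E →L[ℂ] E := fun t =>
    continuousLinearMapOfTendsto (l := atTop) (fun n => V n t) (f := u t) (tendsto_pi_nhds.2 (hu t))
  have hU : ∀ t y, Tendsto (fun n => V n t y) atTop (𝓝 (U t y)) := hu
  clear_value U
  have hUn : ∀ t x, ‖U t x‖ = ‖x‖ := fun t x =>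
    tendsto_nhds_unique (hU t x).norm (by simp only [hVn]; exact tendsto_const_nhds)
  have hU0 : U 0 = 1 := by
    ext x
    exact tendsto_nhds_unique (hU 0 x) (by simp only [hV0]; exact tendsto_const_nhds)
  have hUa : ∀ s t, U (s + t) = U s * U t := by
    intro s t
    ext x
    refine tendsto_nhds_unique (hU (s + t) x) ?_
    have h1 : Tendsto (fun n => V n s (V n t x - U t x)) atTop (𝓝 0) := by
      rw [tendsto_zero_iff_norm_tendsto_zero]
      simp only [hVn]
      exact tendsto_iff_norm_sub_tendsto_zero.1 (hU t x)
    have h2 := h1.add (hU s (U t x))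
    rw [zero_add] at h2
    refine h2.congr fun n => ?_
    rw [hVa, map_sub, sub_add_cancel]; rfl
  have hU1 : ∀ x y, (x, y) ∈ H.graph → ∀ t, ‖U t x - x‖ ≤ ‖y‖ * |t| := by
    intro x y hxy t
    exact le_of_tendsto_of_tendsto' ((hU t x).sub_const x).norm
      ((hTl x y hxy).norm.mul_const |t|) fun n => hV1 n t x
  have hUunit : ∀ t, U t ∈ unitary (E →L[ℂ] E) := by
    intro t
    have h1 : star (U t) * U t = 1 :=
      (ContinuousLinearMap.norm_map_iff_adjoint_comp_self (U t)).1 (hUn t)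
    have h2 : U t * U (-t) = 1 := by rw [← hUa, add_neg_cancel, hU0]
    have h3 : star (U t) = U (-t) := by
      calc star (U t) = star (U t) * (U t * U (-t)) := by rw [h2, mul_one]
        _ = U (-t) := by rw [← mul_assoc, h1, one_mul]
    rw [Unitary.mem_iff]
    exact ⟨h1, by rw [h3, h2]⟩
  have hder : ∀ x y, (x, y) ∈ H.graph → ∀ w w', (w, w') ∈ H.graph → ∀ t : ℝ,
      ‖U t x - x - t • (Complex.I • y)‖ ≤
        (2 * ‖Complex.I • y - w‖ + ‖w'‖ * |t|) * |t| := by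
    intro x y hxy w w' hw t
    have hlim : Tendsto (fun n => (‖T n x - y‖ + (2 * ‖Complex.I • y - w‖ + ‖T n w‖ * |t|)) * |t|)
        atTop (𝓝 ((0 + (2 * ‖Complex.I • y - w‖ + ‖w'‖ * |t|)) * |t|)) :=
      ((tendsto_iff_norm_sub_tendsto_zero.1 (hTl x y hxy)).add
        (((hTl w w' hw).norm.mul_const |t|).const_add _)).mul_const _
    rw [zero_add] at hlim
    refine le_of_tendsto_of_tendsto' (((hU t x).sub_const x).sub_const _).norm hlim fun n => ?_
    have hd : ∀ s : ℝ, HasDerivAt (fun s : ℝ => V n s x - s • (Complex.I • y))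
        (V n s (Complex.I • T n x) - Complex.I • y) s := fun s => by
      have := (hVder n s x).sub ((hasDerivAt_id s).smul_const (Complex.I • y))
      rw [one_smul] at this
      exact this
    have hb : ∀ s ∈ Set.uIcc (0 : ℝ) t, ‖V n s (Complex.I • T n x) - Complex.I • y‖ ≤
        ‖T n x - y‖ + (2 * ‖Complex.I • y - w‖ + ‖T n w‖ * |t|) := by
      intro s hs
      have hst : |s| ≤ |t| := by simpa using Set.abs_sub_left_of_mem_uIcc hs
      have h1 : V n s (Complex.I • T n x) - Complex.I • y =
          V n s (Complex.I • (T n x - y)) + (V n s (Complex.I • y - w) + (V n s w - w) -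
            (Complex.I • y - w)) := by
        simp only [map_sub, smul_sub]; abel
      rw [h1]
      have h2 := norm_add_le (V n s (Complex.I • (T n x - y)))
        (V n s (Complex.I • y - w) + (V n s w - w) - (Complex.I • y - w))
      have h3 := norm_sub_le (V n s (Complex.I • y - w) + (V n s w - w)) (Complex.I • y - w)
      have h4 := norm_add_le (V n s (Complex.I • y - w)) (V n s w - w)
      have h5 := hV1 n s w
      have h6 := mul_le_mul_of_nonneg_left hst (norm_nonneg (T n w))
      rw [hVn, norm_smul, Complex.norm_I, one_mul] at h2
      rw [hVn] at h4
      linarith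
    have := Convex.norm_image_sub_le_of_norm_hasDerivWithin_le (s := Set.uIcc (0 : ℝ) t)
      (x := (0 : ℝ)) (y := t) (fun s _ => (hd s).hasDerivWithinAt) hb (convex_uIcc _ _)
      Set.left_mem_uIcc Set.right_mem_uIcc
    simp only [hV0, zero_smul, sub_zero, Real.norm_eq_abs] at this
    have h7 : V n t x - x - t • (Complex.I • y) =
        V n t x - t • (Complex.I • y) - (1 : E →L[ℂ] E) x := by
      change _ = V n t x - t • (Complex.I • y) - x
      abel
    rw [h7]
    exact this
  have hder' : ∀ x y, (x, y) ∈ H.graph → HasDerivAt (fun t => U t x) (Complex.I • y) 0 := by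
    intro x y hxy
    rw [hasDerivAt_iff_isLittleO_nhds_zero, Asymptotics.isLittleO_iff]
    intro c hc
    obtain ⟨w, w', hw, hwn⟩ := happ (Complex.I • y) (c / 4) (by positivity)
    have hpos : 0 < c / (2 * (‖w'‖ + 1)) := by positivity
    filter_upwards [Metric.ball_mem_nhds (0 : ℝ) hpos] with t ht
    rw [Metric.mem_ball, dist_zero_right, Real.norm_eq_abs, lt_div_iff₀ (by positivity)] at ht
    have h1 := hder x y hxy w w' hw t
    simp only [zero_add, hU0]
    refine h1.trans ?_
    rw [Real.norm_eq_abs]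
    refine mul_le_mul_of_nonneg_right ?_ (abs_nonneg t)
    nlinarith [abs_nonneg t]
  have hcont0 : ∀ x, ContinuousAt (fun t => U t x) 0 := by
    intro x
    rw [Metric.continuousAt_iff]
    intro ε hε
    obtain ⟨w, w', hw, hwn⟩ := happ x (ε / 4) (by positivity)
    refine ⟨ε / (2 * (‖w'‖ + 1)), by positivity, fun {t} ht => ?_⟩
    rw [dist_zero_right, Real.norm_eq_abs, lt_div_iff₀ (by positivity)] at ht
    rw [dist_eq_norm, hU0]
    have h1 : U t x - (1 : E →L[ℂ] E) x = U t (x - w) + (U t w - w) - (x - w) := by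
      simp only [map_sub]
      change U t x - x = _
      abel
    rw [h1]
    have h3 := norm_sub_le (U t (x - w) + (U t w - w)) (x - w)
    have h4 := norm_add_le (U t (x - w)) (U t w - w)
    have h5 := hU1 w w' hw t
    rw [hUn] at h4
    nlinarith [abs_nonneg t]
  refine ⟨U, hUunit, hU0, hUa, fun x => ?_, fun x y => ⟨hder' x y, fun h => ?_⟩⟩
  · rw [continuous_iff_continuousAt]
    intro s
    have h1 : (fun t => U t x) = fun t => U s (U (t - s) x) := by
      funext t
      conv_lhs => rw [← add_sub_cancel s t, hUa]
      rfl
    rw [h1]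
    refine (U s).continuous.continuousAt.comp ?_
    have h2 : ContinuousAt (fun t : ℝ => U t x) (s - s) := by rw [sub_self]; exact hcont0 x
    exact ContinuousAt.comp (f := fun t : ℝ => t - s) h2 (by fun_prop)
  · rw [mem_graph_iff_forall hH]
    intro a b hab
    have h1 := (hder' a b hab).inner ℂ h
    simp only [ContinuousLinearMap.inner_map_map_of_mem_unitary (hUunit _), hU0] at h1
    have h2 := h1.unique (hasDerivAt_const _ _)
    change inner ℂ a (Complex.I • y) + inner ℂ (Complex.I • b) x = 0 at h2
    rw [inner_smul_right, inner_smul_left, Complex.conj_I] at h2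
    have h3 : Complex.I * (inner ℂ a y - inner ℂ b x) = 0 := by linear_combination h2
    have h4 := (mul_eq_zero.1 h3).resolve_left Complex.I_ne_zero
    exact (sub_eq_zero.1 h4).symm

theorem IsUnitaryGroup.hasDerivAt {U : ℝ → E →L[ℂ] E} (hU : IsUnitaryGroup H U) {x y : E}
    (h : (x, y) ∈ H.graph) (t : ℝ) :
    HasDerivAt (fun s => U s x) (Complex.I • U t y) t := by
  have h1 : HasDerivAt (fun s : ℝ => U s x) (Complex.I • y) (t - t) := by
    rw [sub_self]; exact (hU.generator x y).1 h
  have h2 := ((U t).restrictScalars ℝ).hasFDerivAt.comp_hasDerivAt t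
    (h1.comp_sub_const t t)
  rw [ContinuousLinearMap.coe_restrictScalars', map_smul] at h2
  refine h2.congr_of_eventuallyEq (Eventually.of_forall fun s => ?_)
  change U s x = U t (U (s - t) x)
  conv_lhs => rw [← add_sub_cancel t s, hU.add]
  rfl

theorem IsUnitaryGroup.map_graph {U : ℝ → E →L[ℂ] E} (hU : IsUnitaryGroup H U) {x y : E}
    (h : (x, y) ∈ H.graph) (t : ℝ) : (U t x, U t y) ∈ H.graph := by
  rw [hU.generator]
  have h2 := ((U t).restrictScalars ℝ).hasFDerivAt.comp_hasDerivAt (0 : ℝ)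
    ((hU.generator x y).1 h)
  rw [ContinuousLinearMap.coe_restrictScalars', map_smul] at h2
  refine h2.congr_of_eventuallyEq (Eventually.of_forall fun s => ?_)
  change (U s * U t) x = (U t * U s) x
  rw [← hU.add, ← hU.add, add_comm]

theorem IsUnitaryGroup.inner_left {U : ℝ → E →L[ℂ] E} (hU : IsUnitaryGroup H U) (t : ℝ) (x y : E) :
    inner ℂ (U t x) y = inner ℂ x (U (-t) y) := by
  have h : U t (U (-t) y) = y := by
    change (U t * U (-t)) y = y
    rw [← hU.add, add_neg_cancel, hU.zero]; rfl
  conv_lhs => rw [← h]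
  exact ContinuousLinearMap.inner_map_map_of_mem_unitary (hU.unitary t) _ _

/-- The group generated by `i H` is unique. -/
theorem IsUnitaryGroup.unique (hH : IsSelfAdjoint H) {U V : ℝ → E →L[ℂ] E}
    (hU : IsUnitaryGroup H U) (hV : IsUnitaryGroup H V) : U = V := by
  funext t
  have key : ∀ x y, (x, y) ∈ H.graph → U t x = V t x := by
    intro x y hxy
    have h1 : V (-t) (U t x) = x := by
      refine hH.dense_domain.eq_of_inner_right ℂ fun a ha => ?_
      have hab := H.mem_graph ⟨a, ha⟩
      have hd : ∀ s, HasDerivAt (fun s => inner ℂ (V s a) (U s x)) 0 s := by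
        intro s
        have h2 := (hV.hasDerivAt hab s).inner ℂ (hU.hasDerivAt hxy s)
        have h3 := graph_symm hH (hU.map_graph hxy s) (hV.map_graph hab s)
        rw [inner_smul_left, inner_smul_right, Complex.conj_I, h3] at h2
        rwa [neg_mul, add_neg_cancel] at h2
      have h4 := is_const_of_deriv_eq_zero (fun s => (hd s).differentiableAt)
        (fun s => (hd s).deriv) t 0
      simp only [hU.zero, hV.zero] at h4
      rw [← hV.inner_left, h4]
      rfl
    have h5 : V t (V (-t) (U t x)) = U t x := by
      change (V t * V (-t)) _ = _
      rw [← hV.add, add_neg_cancel, hV.zero]; rfl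
    rw [← h5, h1]
  refine ContinuousLinearMap.ext fun x => ?_
  exact congrFun (Continuous.ext_on hH.dense_domain (U t).continuous (V t).continuous
    fun a ha => key a _ (H.mem_graph ⟨a, ha⟩)) x

/-- `exp (i t H)`: the unique strongly continuous one-parameter unitary group with generator
`i H`. -/
noncomputable def unitaryGroup (hH : IsSelfAdjoint H) : ℝ → E →L[ℂ] E :=
  Classical.choose (exists_isUnitaryGroup hH)

theorem unitaryGroup_spec (hH : IsSelfAdjoint H) : IsUnitaryGroup H (unitaryGroup hH) :=
  Classical.choose_spec (exists_isUnitaryGroup hH)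

/-- `(H - i)⁻¹`: the unique bounded inverse of `H - i : dom H → E`. -/
noncomputable def resolventI (hH : IsSelfAdjoint H) : E →L[ℂ] E :=
  Classical.choose (exists_isResolvent hH (z := Complex.I) (by simp))

theorem resolventI_spec (hH : IsSelfAdjoint H) : IsResolvent H Complex.I (resolventI hH) :=
  Classical.choose_spec (exists_isResolvent hH (z := Complex.I) (by simp))

/-- `S ∈ C¹(A)`: the map `t ↦ exp (-i t A) S exp (i t A)` is strongly of class `C¹`. -/
def IsC1 (hA : IsSelfAdjoint A) (S : E →L[ℂ] E) : Prop :=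
  ∀ x, ContDiff ℝ 1 fun t : ℝ => unitaryGroup hA (-t) (S (unitaryGroup hA t x))

/-- `q` is a sesquilinear form on `dom H`, continuous for the graph topology of `H`, which extends
the form `(φ, ψ) ↦ ⟨H φ, A ψ⟩ - ⟨A φ, H ψ⟩` on `dom H ∩ dom A`. -/
structure IsCommutatorForm (H A : E →ₗ.[ℂ] E) (q : H.domain →ₗ⋆[ℂ] H.domain →ₗ[ℂ] ℂ) : Prop where
  bound : ∃ C : ℝ, ∀ x y, ‖q x y‖ ≤ C * (‖(x : E)‖ + ‖H x‖) * (‖(y : E)‖ + ‖H y‖)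
  extends_form : ∀ (x y : H.domain) (hx : (x : E) ∈ A.domain) (hy : (y : E) ∈ A.domain),
    q x y = inner ℂ (H x) (A ⟨y, hy⟩) - inner ℂ (A ⟨x, hx⟩) (H y)

/-- The strong derivative at zero. -/
theorem IsC1.exists_deriv (hA : IsSelfAdjoint A) {S : E →L[ℂ] E} (hS : IsC1 hA S) :
    ∃ T : E →L[ℂ] E, ∀ x, HasDerivAt
      (fun t : ℝ => unitaryGroup hA (-t) (S (unitaryGroup hA t x))) (T x) 0 := by
  have hd : ∀ x, ∃ y, HasDerivAt
      (fun t : ℝ => unitaryGroup hA (-t) (S (unitaryGroup hA t x))) y 0 := fun x =>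
    ⟨_, ((hS x).differentiable one_ne_zero).differentiableAt.hasDerivAt⟩
  choose f hf using hd
  have hz : ∀ x, unitaryGroup hA (-0) (S (unitaryGroup hA 0 x)) = S x := by
    intro x
    rw [neg_zero, (unitaryGroup_spec hA).zero]; rfl
  have hl : Tendsto (fun (t : ℝ) x => ((((t : ℂ))⁻¹ •
      (unitaryGroup hA (-t) * S * unitaryGroup hA t - S) : E →L[ℂ] E) : E → E) x)
      (𝓝[≠] 0) (𝓝 f) := by
    rw [tendsto_pi_nhds]
    intro x
    refine (hasDerivAt_iff_tendsto_slope_zero.1 (hf x)).congr fun t => ?_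
    rw [zero_add, hz, ← Complex.coe_smul, Complex.ofReal_inv]
    rfl
  exact ⟨continuousLinearMapOfTendsto _ hl, hf⟩

/-- Strong convergence of unitaries applied to a convergent net. -/
theorem tendsto_unitary_apply (hA : IsSelfAdjoint A) {l : Filter ℝ} {c : ℝ → ℝ}
    (hc : Tendsto c l (𝓝 0)) {v : ℝ → E} {w : E} (hv : Tendsto v l (𝓝 w)) :
    Tendsto (fun t => unitaryGroup hA (c t) (v t)) l (𝓝 w) := by
  have hU := unitaryGroup_spec hA
  have h1 : Tendsto (fun t => unitaryGroup hA (c t) (v t - w)) l (𝓝 0) := by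
    rw [tendsto_zero_iff_norm_tendsto_zero]
    simp only [ContinuousLinearMap.norm_map_of_mem_unitary (hU.unitary _)]
    exact tendsto_iff_norm_sub_tendsto_zero.1 hv
  have h2 : Tendsto (fun t => unitaryGroup hA (c t) w) l (𝓝 w) := by
    have := ((hU.continuous w).tendsto 0).comp hc
    rw [hU.zero] at this
    exact this
  have h3 := h1.add h2
  rw [zero_add] at h3
  exact h3.congr fun t => by rw [map_sub, sub_add_cancel]

/-- Derivative of the group in the form of difference quotients with complex scalars. -/
theorem tendsto_quotient (hA : IsSelfAdjoint A) {x y : E} (h : (x, y) ∈ A.graph) :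
    Tendsto (fun t : ℝ => ((t : ℂ))⁻¹ • (unitaryGroup hA t x - x)) (𝓝[≠] 0)
      (𝓝 (Complex.I • y)) := by
  have hU := unitaryGroup_spec hA
  refine (hasDerivAt_iff_tendsto_slope_zero.1 ((hU.generator x y).1 h)).congr fun t => ?_
  rw [zero_add, hU.zero, ← Complex.coe_smul, Complex.ofReal_inv]
  rfl

theorem tendsto_quotient_neg (hA : IsSelfAdjoint A) {x y : E} (h : (x, y) ∈ A.graph) :
    Tendsto (fun t : ℝ => ((t : ℂ))⁻¹ • (unitaryGroup hA (-t) x - x)) (𝓝[≠] 0)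
      (𝓝 (-(Complex.I • y))) := by
  have hn : Tendsto (fun t : ℝ => -t) (𝓝[≠] 0) (𝓝[≠] 0) := by
    refine tendsto_nhdsWithin_iff.2 ⟨?_, ?_⟩
    · have : Tendsto (fun t : ℝ => -t) (𝓝 0) (𝓝 (-0)) := continuous_neg.tendsto 0
      rw [neg_zero] at this
      exact this.mono_left nhdsWithin_le_nhds
    · filter_upwards [self_mem_nhdsWithin] with t ht
      exact neg_ne_zero.2 ht
  refine ((tendsto_quotient hA h).comp hn).neg.congr fun t => ?_
  simp only [Function.comp_apply, Complex.ofReal_neg]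
  rw [inv_neg, neg_smul, neg_neg]

/-- `[S, exp (i t A)] / t` converges strongly. -/
theorem tendsto_comm_quotient (hA : IsSelfAdjoint A) {S T : E →L[ℂ] E}
    (hT : ∀ x, HasDerivAt
      (fun t : ℝ => unitaryGroup hA (-t) (S (unitaryGroup hA t x))) (T x) 0) (x : E) :
    Tendsto (fun t : ℝ => ((t : ℂ))⁻¹ •
      (S (unitaryGroup hA t x) - unitaryGroup hA t (S x))) (𝓝[≠] 0) (𝓝 (T x)) := by
  have hU := unitaryGroup_spec hA
  have hz : unitaryGroup hA (-0) (S (unitaryGroup hA 0 x)) = S x := by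
    rw [neg_zero, hU.zero]; rfl
  have h1 := hasDerivAt_iff_tendsto_slope_zero.1 (hT x)
  have hc : Tendsto (fun t : ℝ => t) (𝓝[≠] 0) (𝓝 0) := tendsto_id.mono_left nhdsWithin_le_nhds
  refine (tendsto_unitary_apply hA hc h1).congr fun t => ?_
  rw [zero_add, hz, ← Complex.coe_smul, Complex.ofReal_inv, map_smul, map_sub]
  congr 2
  change (unitaryGroup hA t * unitaryGroup hA (-t)) _ = _
  rw [← hU.add, add_neg_cancel, hU.zero]
  rfl

/-- An operator of class `C¹(A)` preserves `dom A`. -/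
theorem IsC1.map_domain (hA : IsSelfAdjoint A) {S : E →L[ℂ] E} (hS : IsC1 hA S) {x : E}
    (hx : x ∈ A.domain) : S x ∈ A.domain := by
  obtain ⟨T, hT⟩ := hS.exists_deriv
  have hU := unitaryGroup_spec hA
  have hxy := A.mem_graph ⟨x, hx⟩
  have h1 := (((S.continuous.tendsto _).comp (tendsto_quotient hA hxy)).sub
    (tendsto_comm_quotient hA hT x))
  have h2 : Tendsto (fun t : ℝ => ((t : ℂ))⁻¹ • (unitaryGroup hA t (S x) - S x)) (𝓝[≠] 0)
      (𝓝 (S (Complex.I • A ⟨x, hx⟩) - T x)) := by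
    refine h1.congr fun t => ?_
    simp only [Function.comp_apply, map_smul, map_sub]
    rw [← smul_sub]
    congr 1
    abel
  refine LinearPMap.mem_domain_of_mem_graph
    (y := -(Complex.I • (S (Complex.I • A ⟨x, hx⟩) - T x))) ((hU.generator _ _).2 ?_)
  rw [hasDerivAt_iff_tendsto_slope_zero]
  have h3 : Complex.I • -(Complex.I • (S (Complex.I • A ⟨x, hx⟩) - T x)) =
      S (Complex.I • A ⟨x, hx⟩) - T x := by
    rw [smul_neg, smul_smul, Complex.I_mul_I, neg_smul, one_smul, neg_neg]
  rw [h3]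
  refine h2.congr fun t => ?_
  rw [zero_add, hU.zero, ← Complex.coe_smul, Complex.ofReal_inv]
  rfl

/-- Existence of the commutator form. -/
theorem exists_isCommutatorForm (hH : IsSelfAdjoint H) (hA : IsSelfAdjoint A)
    (hC : IsC1 hA (resolventI hH)) : ∃ q, IsCommutatorForm H A q := by
  obtain ⟨T, hT⟩ := hC.exists_deriv
  have hU := unitaryGroup_spec hA
  have hR := resolventI_spec hH
  let P : H.domain →ₗ[ℂ] E := H.toFun + Complex.I • H.domain.subtype
  let M : H.domain →ₗ[ℂ] E := H.toFun - Complex.I • H.domain.subtype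
  have hP : ∀ x, P x = H x + Complex.I • (x : E) := fun _ => rfl
  have hM : ∀ x, M x = H x - Complex.I • (x : E) := fun _ => rfl
  let q : H.domain →ₗ⋆[ℂ] H.domain →ₗ[ℂ] ℂ :=
    LinearMap.mk₂'ₛₗ (starRingEnd ℂ) (RingHom.id ℂ)
      (fun x y => Complex.I * inner ℂ (P x) (T (M y)))
      (fun x x' y => by rw [map_add, inner_add_left, mul_add])
      (fun c x y => by
        rw [map_smul, inner_smul_left, smul_eq_mul]; ring)
      (fun x y y' => by rw [map_add, map_add, inner_add_right, mul_add])
      (fun c x y => by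
        rw [map_smul, map_smul, inner_smul_right, smul_eq_mul, RingHom.id_apply]; ring)
  have hq : ∀ x y, q x y = Complex.I * inner ℂ (P x) (T (M y)) := fun _ _ => rfl
  refine ⟨q, ⟨‖T‖, fun x y => ?_⟩, fun x y hx hy => ?_⟩
  · have h1 : ‖P x‖ ≤ ‖(x : E)‖ + ‖H x‖ := by
      rw [hP]
      refine (norm_add_le _ _).trans ?_
      rw [norm_smul, Complex.norm_I, one_mul, add_comm]
    have h2 : ‖M y‖ ≤ ‖(y : E)‖ + ‖H y‖ := by
      rw [hM]
      refine (norm_sub_le _ _).trans ?_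
      rw [norm_smul, Complex.norm_I, one_mul, add_comm]
    rw [hq, norm_mul, Complex.norm_I, one_mul]
    calc ‖inner ℂ (P x) (T (M y))‖ ≤ ‖P x‖ * ‖T (M y)‖ := norm_inner_le_norm _ _
      _ ≤ ‖P x‖ * (‖T‖ * ‖M y‖) := by gcongr; exact T.le_opNorm _
      _ = ‖T‖ * ‖P x‖ * ‖M y‖ := by ring
      _ ≤ _ := by gcongr
  · have hgx := H.mem_graph x
    have hgy := H.mem_graph y
    have hRM : resolventI hH (M y) = y := hR.left_inv _ _ hgy
    have hRP : ∀ v, inner ℂ (P x) (resolventI hH v) = inner ℂ (x : E) v := by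
      intro v
      have := graph_symm hH (hR.graph v) hgx
      rw [hP, inner_add_left, inner_smul_left, Complex.conj_I, this, inner_add_right,
        inner_smul_right]
      ring
    have h1 : Tendsto (fun t : ℝ => inner ℂ (P x) (((t : ℂ))⁻¹ • (resolventI hH
        (unitaryGroup hA t (M y)) - unitaryGroup hA t (resolventI hH (M y))))) (𝓝[≠] 0)
        (𝓝 (inner ℂ (P x) (T (M y)))) :=
      tendsto_const_nhds.inner (tendsto_comm_quotient hA hT (M y))
    have hgAx := A.mem_graph ⟨x, hx⟩
    have hgAy := A.mem_graph ⟨y, hy⟩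
    have h2 : Tendsto (fun t : ℝ =>
        inner ℂ (((t : ℂ))⁻¹ • (unitaryGroup hA (-t) (x : E) - x)) (M y) -
        inner ℂ (P x) (((t : ℂ))⁻¹ • (unitaryGroup hA t (y : E) - y))) (𝓝[≠] 0)
        (𝓝 (inner ℂ (-(Complex.I • A ⟨x, hx⟩)) (M y) - inner ℂ (P x) (Complex.I • A ⟨y, hy⟩))) :=
      ((tendsto_quotient_neg hA hgAx).inner tendsto_const_nhds).sub
        (tendsto_const_nhds.inner (tendsto_quotient hA hgAy))
    have h3 : inner ℂ (P x) (T (M y)) =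
        inner ℂ (-(Complex.I • A ⟨x, hx⟩)) (M y) - inner ℂ (P x) (Complex.I • A ⟨y, hy⟩) := by
      refine tendsto_nhds_unique h1 (h2.congr fun t => ?_)
      have h4 := hRP (M y)
      rw [hRM] at h4
      have h5 := hU.inner_left (-t) (x : E) (M y)
      rw [neg_neg] at h5
      rw [hRM]
      simp only [inner_smul_left, inner_smul_right, inner_sub_left, inner_sub_right, hRP, h4, h5,
        map_inv₀, Complex.conj_ofReal]
      ring
    have h6 := graph_symm hA hgAy hgAx
    simp only at h6
    rw [hq, h3, hP, hM]
    simp only [inner_neg_left, inner_smul_left, inner_smul_right, inner_sub_right, inner_add_left,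
      Complex.conj_I, h6]
    linear_combination (inner ℂ (A ⟨x, hx⟩) (H y) - inner ℂ (H x) (A ⟨y, hy⟩)) * Complex.I_sq

/-- The subspace `dom H ∩ dom A` is a core for `H`. -/
theorem exists_core_approx (hH : IsSelfAdjoint H) (hA : IsSelfAdjoint A)
    (hC : IsC1 hA (resolventI hH)) (x : H.domain) {ε : ℝ} (hε : 0 < ε) :
    ∃ x' : H.domain, (x' : E) ∈ A.domain ∧ ‖((x - x' : H.domain) : E)‖ + ‖H (x - x')‖ < ε := by
  have hR := resolventI_spec hH
  obtain ⟨a, ha, ha'⟩ := Metric.dense_iff.1 hA.dense_domain (H x - Complex.I • (x : E)) (ε / 3)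
    (by positivity)
  have hg := hR.graph a
  obtain ⟨x', hx', hx2⟩ := H.mem_graph_iff.1 hg
  simp only at hx' hx2
  refine ⟨x', by rw [hx']; exact hC.map_domain hA ha', ?_⟩
  have hxx := hR.left_inv _ _ (H.mem_graph x)
  have h1 : ((x - x' : H.domain) : E) = resolventI hH (H x - Complex.I • (x : E) - a) := by
    rw [map_sub, hxx, Submodule.coe_sub, hx']
  have h2 : H (x - x') = (H x - Complex.I • (x : E) - a) + Complex.I • ((x - x' : H.domain) : E) := by
    rw [LinearPMap.map_sub, hx2, Submodule.coe_sub, hx', smul_sub]; abel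
  have h3 := hR.norm_le hH (H x - Complex.I • (x : E) - a)
  rw [← h1, Complex.I_im, abs_one, one_mul] at h3
  have h4 := norm_add_le (H x - Complex.I • (x : E) - a) (Complex.I • ((x - x' : H.domain) : E))
  rw [norm_smul, Complex.norm_I, one_mul, ← h2] at h4
  have h5 : ‖H x - Complex.I • (x : E) - a‖ < ε / 3 := by
    rw [← dist_eq_norm, dist_comm]; exact ha
  linarith

/-- The commutator form is unique. -/
theorem IsCommutatorForm.unique (hH : IsSelfAdjoint H) (hA : IsSelfAdjoint A)
    (hC : IsC1 hA (resolventI hH)) {q q' : H.domain →ₗ⋆[ℂ] H.domain →ₗ[ℂ] ℂ}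
    (hq : IsCommutatorForm H A q) (hq' : IsCommutatorForm H A q') : q = q' := by
  obtain ⟨C, hC1⟩ := hq.bound
  obtain ⟨C', hC'1⟩ := hq'.bound
  have hb : ∀ x y, ‖(q - q') x y‖ ≤
      (|C| + |C'|) * (‖(x : E)‖ + ‖H x‖) * (‖(y : E)‖ + ‖H y‖) := by
    intro x y
    refine (norm_sub_le (q x y) (q' x y)).trans ((add_le_add (hC1 x y) (hC'1 x y)).trans ?_)
    rw [add_mul, add_mul]
    gcongr
    · exact le_abs_self C
    · exact le_abs_self C'
  have h0 : ∀ x y : H.domain, (x : E) ∈ A.domain → (y : E) ∈ A.domain → (q - q') x y = 0 := by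
    intro x y hx hy
    change q x y - q' x y = 0
    rw [hq.extends_form x y hx hy, hq'.extends_form x y hx hy, sub_self]
  have hsmall : ∀ (K : ℝ) (z : ℂ), 0 ≤ K → (∀ ε > 0, ‖z‖ ≤ K * ε) → z = 0 := by
    intro K z hK h
    rw [← norm_le_zero_iff]
    refine le_of_forall_pos_le_add fun ε hε => ?_
    have := h (ε / (K + 1)) (by positivity)
    refine this.trans ?_
    rw [zero_add, ← mul_div_assoc, div_le_iff₀ (by positivity)]
    nlinarith
  have h1 : ∀ x y : H.domain, (x : E) ∈ A.domain → (q - q') x y = 0 := by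
    intro x y hx
    refine hsmall ((|C| + |C'|) * (‖(x : E)‖ + ‖H x‖)) _ (by positivity) fun ε hε => ?_
    obtain ⟨y', hy', hyy⟩ := exists_core_approx hH hA hC y hε
    have h2 : (q - q') x y = (q - q') x (y - y') := by rw [map_sub, h0 x y' hx hy', sub_zero]
    rw [h2]
    exact (hb _ _).trans (by gcongr)
  have h2 : ∀ x y : H.domain, (q - q') x y = 0 := by
    intro x y
    refine hsmall ((|C| + |C'|) * (‖(y : E)‖ + ‖H y‖)) _ (by positivity) fun ε hε => ?_
    obtain ⟨x', hx', hxx⟩ := exists_core_approx hH hA hC x hε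
    have h2 : (q - q') x y = (q - q') (x - x') y := by
      have h3 : (q - q') (x - x') = (q - q') x - (q - q') x' := map_sub _ _ _
      rw [h3]
      change _ = (q - q') x y - (q - q') x' y
      rw [h1 x' y hx', sub_zero]
    rw [h2]
    refine (hb _ _).trans ?_
    calc _ ≤ (|C| + |C'|) * ε * (‖(y : E)‖ + ‖H y‖) := by gcongr
      _ = _ := by ring
  exact sub_eq_zero.1 (LinearMap.ext fun x => LinearMap.ext fun y => h2 x y)

/-- The commutator `[H, A]`, as a continuous sesquilinear form on `dom H` (equivalently, as an
operator from `dom H` to its adjoint space). -/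
noncomputable def commutatorForm (hH : IsSelfAdjoint H) (hA : IsSelfAdjoint A)
    (hC : IsC1 hA (resolventI hH)) : H.domain →ₗ⋆[ℂ] H.domain →ₗ[ℂ] ℂ :=
  Classical.choose (exists_isCommutatorForm hH hA hC)

theorem commutatorForm_spec (hH : IsSelfAdjoint H) (hA : IsSelfAdjoint A)
    (hC : IsC1 hA (resolventI hH)) : IsCommutatorForm H A (commutatorForm hH hA hC) :=
  Classical.choose_spec (exists_isCommutatorForm hH hA hC)

/-- `(H - i)⁻¹` as a linear map onto `dom H`. -/
noncomputable def resolventDom (hH : IsSelfAdjoint H) : E →ₗ[ℂ] H.domain :=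
  (resolventI hH).toLinearMap.codRestrict H.domain fun x =>
    LinearPMap.mem_domain_of_mem_graph ((resolventI_spec hH).graph x)

theorem exists_sandwich (hH : IsSelfAdjoint H) (hA : IsSelfAdjoint A)
    (hC : IsC1 hA (resolventI hH)) : ∃ B : E →L[ℂ] E, ∀ φ ψ, inner ℂ φ (B ψ) =
      Complex.I * commutatorForm hH hA hC (resolventDom hH φ) (resolventDom hH ψ) := by
  obtain ⟨C, hb⟩ := (commutatorForm_spec hH hA hC).bound
  have hR := resolventI_spec hH
  have hn : ∀ x, ‖(resolventDom hH x : E)‖ + ‖H (resolventDom hH x)‖ ≤ 3 * ‖x‖ := by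
    intro x
    have h1 : ‖(resolventDom hH x : E)‖ ≤ ‖x‖ := by
      have := hR.norm_le hH x
      rwa [Complex.I_im, abs_one, one_mul] at this
    have h2 : H (resolventDom hH x) = x + Complex.I • (resolventDom hH x : E) :=
      H.mem_graph_snd_inj (H.mem_graph _) (hR.graph x) rfl
    have h3 := norm_add_le x (Complex.I • (resolventDom hH x : E))
    rw [norm_smul, Complex.norm_I, one_mul, ← h2] at h3
    linarith
  let b : E →ₗ⋆[ℂ] E →ₗ[ℂ] ℂ :=
    LinearMap.mk₂'ₛₗ (starRingEnd ℂ) (RingHom.id ℂ)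
      (fun x y => Complex.I * commutatorForm hH hA hC (resolventDom hH x) (resolventDom hH y))
      (fun x x' y => by rw [map_add, map_add, LinearMap.add_apply, mul_add])
      (fun c x y => by
        rw [map_smul, LinearMap.map_smulₛₗ, LinearMap.smul_apply, smul_eq_mul, smul_eq_mul]; ring)
      (fun x y y' => by rw [map_add, map_add, mul_add])
      (fun c x y => by
        rw [map_smul, map_smul, smul_eq_mul, smul_eq_mul, RingHom.id_apply]; ring)
  have hbb : ∀ x y, ‖b x y‖ ≤ (|C| * 9) * ‖x‖ * ‖y‖ := by
    intro x y
    change ‖Complex.I * commutatorForm hH hA hC (resolventDom hH x) (resolventDom hH y)‖ ≤ _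
    rw [norm_mul, Complex.norm_I, one_mul]
    refine (hb _ _).trans ?_
    calc _ ≤ |C| * (3 * ‖x‖) * (3 * ‖y‖) := by
          gcongr
          · exact le_abs_self C
          · exact hn x
          · exact hn y
      _ = _ := by ring
  refine ⟨ContinuousLinearMap.adjoint
    (InnerProductSpace.continuousLinearMapOfBilin (b.mkContinuous₂ _ hbb)), fun φ ψ => ?_⟩
  rw [ContinuousLinearMap.adjoint_inner_right]
  exact InnerProductSpace.continuousLinearMapOfBilin_apply _ _ _

/-- The bounded operator `(H + i)⁻¹ [iH, A] (H - i)⁻¹`. Here `(H + i)⁻¹`, as a map from the adjoint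
space of `dom H` to the Hilbert space, is the adjoint of `(H - i)⁻¹` as a map onto `dom H`, so the
operator `B` is determined by `⟨φ, B ψ⟩ = i [H, A]((H - i)⁻¹ φ, (H - i)⁻¹ ψ)` for all `φ, ψ`. -/
noncomputable def sandwich (hH : IsSelfAdjoint H) (hA : IsSelfAdjoint A)
    (hC : IsC1 hA (resolventI hH)) : E →L[ℂ] E :=
  Classical.choose (exists_sandwich hH hA hC)

theorem sandwich_spec (hH : IsSelfAdjoint H) (hA : IsSelfAdjoint A)
    (hC : IsC1 hA (resolventI hH)) (φ ψ : E) : inner ℂ φ (sandwich hH hA hC ψ) =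
      Complex.I * commutatorForm hH hA hC (resolventDom hH φ) (resolventDom hH ψ) :=
  Classical.choose_spec (exists_sandwich hH hA hC) φ ψ

/-- The time average `(1/t) ∫₀ᵗ exp (i s H) (H + i)⁻¹ [iH, A] (H - i)⁻¹ exp (-i s H) φ ds`. -/
noncomputable def timeAverage (hH : IsSelfAdjoint H) (hA : IsSelfAdjoint A)
    (hC : IsC1 hA (resolventI hH)) (t : ℝ) (φ : E) : E :=
  t⁻¹ • ∫ s in (0 : ℝ)..t, unitaryGroup hH s (sandwich hH hA hC (unitaryGroup hH (-s) φ))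

section Restriction

variable {F : Type*} [NormedAddCommGroup F] [InnerProductSpace ℂ F]

/-- The part of `T` in the subspace `K`: the operator in `K` with graph `graph T ∩ (K × K)`. -/
noncomputable def part (T : F →ₗ.[ℂ] F) (K : Submodule ℂ F) : K →ₗ.[ℂ] K :=
  (T.graph.comap (K.subtype.prodMap K.subtype)).toLinearPMap

theorem mem_part_graph {T : F →ₗ.[ℂ] F} {K : Submodule ℂ F} {x y : K} :
    (x, y) ∈ (part T K).graph ↔ ((x : F), (y : F)) ∈ T.graph := by
  have h : (part T K).graph = T.graph.comap (K.subtype.prodMap K.subtype) := by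
    refine Submodule.toLinearPMap_graph_eq _ fun p hp hp1 => ?_
    have h1 : ((p.1 : F), (p.2 : F)) ∈ T.graph := hp
    have h2 := T.graph_fst_eq_zero_snd h1 (by rw [hp1]; rfl)
    exact Subtype.ext h2
  rw [h]
  rfl

/-- `K` reduces `T`: with `P` the orthogonal projection onto `K`, one has `P T ⊂ T P`. -/
def Reduces (K : Submodule ℂ F) [K.HasOrthogonalProjection] (T : F →ₗ.[ℂ] F) : Prop :=
  ∀ x y, (x, y) ∈ T.graph → (K.starProjection x, K.starProjection y) ∈ T.graph

/-- The point subspace of `T`: the closed linear span of the eigenvectors of `T`. -/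
noncomputable def pointSubspace (T : F →ₗ.[ℂ] F) : Submodule ℂ F :=
  (Submodule.span ℂ {x : F | ∃ μ : ℂ, (x, μ • x) ∈ T.graph}).topologicalClosure

/-- The spectrum of the self-adjoint operator `T` is purely continuous: the continuous subspace,
which is the orthogonal complement of the point subspace, is the whole space. -/
def HasPurelyContinuousSpectrum (T : F →ₗ.[ℂ] F) : Prop :=
  (pointSubspace T)ᗮ = ⊤

end Restriction

end CommutatorMixing

namespace CommutatorMixing

variable {E : Type*} [NormedAddCommGroup E] [InnerProductSpace ℂ E] [CompleteSpace E]
  {H A : E →ₗ.[ℂ] E}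

/-! Write `R = (H - i)⁻¹`, `B = (H + i)⁻¹ [iH, A] (H - i)⁻¹`, `U t = exp (i t H)`, and `M_t` for the
time average of `U s B U (-s)`. Formally `U s B U (-s)` is the `s`-derivative of `U s R* A R U
(-s)`, so that `t M_t = U t (R* A R) U (-t) - R* A R`. Pairing `M_t y` with `U t x` gives `⟨x, U
(-t) M_t y⟩ = (1/t) (⟨A R x, R U (-t) y⟩ - ⟨R U t x, A R y⟩)`. For `x, y` in `dom A`, the vectors `R
x, R y` are again in `dom A`, so this is `O(1/t)`. As `M_t y → D y` and `U (-t)` is isometric, `⟨x,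
U (-t) D y⟩ → 0`. The operator `D` is self-adjoint, so `D (dom A)` is dense in `(ker D)ᗮ`, and the
isometry property extends the decay to all of `(ker D)ᗮ`.

The domain problem in the formal derivative is avoided by replacing `iA` with the bounded quotients
`(exp (iεA) - 1)/ε`; the commutators of `R` with these converge strongly because `R ∈ C¹(A)`. This
is `integral_inner_sandwich`, and `tendsto_inner_unitaryGroup_map` draws the decay from it.

For the spectral part, shifting the averaging window shows that `D` commutes with `U`, so `(ker D)ᗮ`
reduces `H`. An eigenvector there would have matrix elements of constant modulus, against the decay.
-/

/-! ### The Cayley transform of `H` and the difference quotients of `exp (i t A)`. -/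

/-- The operator `W = 1 + 2iR` is the Cayley transform `(H + i)(H - i)⁻¹`, and `(H + i)⁻¹ W = R`. It
serves to write everything with `R` alone, without introducing `(H + i)⁻¹`. -/
theorem inner_resolventI_right (hH : IsSelfAdjoint H) (u v : E) :
    inner ℂ (u + (2 * Complex.I) • resolventI hH u) (resolventI hH v) =
      inner ℂ (resolventI hH u) v := by
  have h := graph_symm hH ((resolventI_spec hH).graph v) ((resolventI_spec hH).graph u)
  simp only [inner_add_left, inner_add_right, inner_smul_left, inner_smul_right, map_mul,
    Complex.conj_I, map_ofNat] at h ⊢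
  linear_combination h

/-- The difference quotient of the group `exp (i t A)` at zero. -/
noncomputable def groupQuotient (hA : IsSelfAdjoint A) (t : ℝ) : E →L[ℂ] E :=
  ((t : ℂ))⁻¹ • (unitaryGroup hA t - 1)

theorem groupQuotient_apply (hA : IsSelfAdjoint A) (t : ℝ) (x : E) :
    groupQuotient hA t x = ((t : ℂ))⁻¹ • (unitaryGroup hA t x - x) := rfl

theorem inner_groupQuotient_right (hA : IsSelfAdjoint A) (t : ℝ) (x y : E) :
    inner ℂ x (groupQuotient hA t y) =
      inner ℂ (((t : ℂ))⁻¹ • (unitaryGroup hA (-t) x - x)) y := by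
  have h := (unitaryGroup_spec hA).inner_left (-t) x y
  rw [neg_neg] at h
  rw [groupQuotient_apply, inner_smul_left, inner_smul_right, inner_sub_left, inner_sub_right, h,
    map_inv₀, Complex.conj_ofReal]

theorem tendsto_commutator_groupQuotient (hA : IsSelfAdjoint A) {S T : E →L[ℂ] E}
    (hT : ∀ x, HasDerivAt
      (fun t : ℝ => unitaryGroup hA (-t) (S (unitaryGroup hA t x))) (T x) 0) (x : E) :
    Tendsto (fun t : ℝ => (S * groupQuotient hA t - groupQuotient hA t * S) x) (𝓝[≠] 0)
      (𝓝 (T x)) := by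
  refine (tendsto_comm_quotient hA hT x).congr fun t => ?_
  change _ = S (groupQuotient hA t x) - groupQuotient hA t (S x)
  rw [groupQuotient_apply, groupQuotient_apply, map_smul, map_sub, ← smul_sub]
  congr 1
  abel

/-- Only the left vector has to lie in `dom A`: the adjoint of the quotient is the one of `exp (-i t
A)`, which converges on that vector. -/
theorem tendsto_inner_groupQuotient (hA : IsSelfAdjoint A) {x a : E} (h : (x, a) ∈ A.graph)
    (y : E) : Tendsto (fun t : ℝ => inner ℂ x (groupQuotient hA t y)) (𝓝[≠] 0)
      (𝓝 (Complex.I * inner ℂ a y)) := by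
  simp only [inner_groupQuotient_right]
  have := (tendsto_quotient_neg hA h).inner (tendsto_const_nhds (x := y)) (𝕜 := ℂ)
  rwa [inner_neg_left, inner_smul_left, Complex.conj_I, neg_mul, neg_neg] at this

/-! ### The bounded operator `B`: explicit form, link with the derivative of the resolvent,
symmetry. -/

theorem sandwich_of_mem_graph (hH : IsSelfAdjoint H) (hA : IsSelfAdjoint A)
    (hC : IsC1 hA (resolventI hH)) {u v a b : E} (ha : (resolventI hH u, a) ∈ A.graph)
    (hb : (resolventI hH v, b) ∈ A.graph) :
    inner ℂ u (sandwich hH hA hC v) =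
      Complex.I * (inner ℂ (u + Complex.I • resolventI hH u) b -
        inner ℂ a (v + Complex.I • resolventI hH v)) := by
  have hR := resolventI_spec hH
  have hd : ∀ x, H (resolventDom hH x) = x + Complex.I • resolventI hH x := fun x =>
    H.mem_graph_snd_inj (H.mem_graph _) (hR.graph x) rfl
  have hx : ((resolventDom hH u : H.domain) : E) ∈ A.domain :=
    LinearPMap.mem_domain_of_mem_graph ha
  have hy : ((resolventDom hH v : H.domain) : E) ∈ A.domain :=
    LinearPMap.mem_domain_of_mem_graph hb
  have hAx : A ⟨_, hx⟩ = a := A.mem_graph_snd_inj (A.mem_graph _) ha rfl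
  have hAy : A ⟨_, hy⟩ = b := A.mem_graph_snd_inj (A.mem_graph _) hb rfl
  rw [sandwich_spec, (commutatorForm_spec hH hA hC).extends_form _ _ hx hy, hAx, hAy, hd, hd]

/-- Equality of two continuous sesquilinear expressions on a dense set. -/
theorem inner_eq_of_dense {s : Set E} (hs : Dense s) {S T S' T' : E →L[ℂ] E}
    (h : ∀ u ∈ s, ∀ v ∈ s, inner ℂ (S u) (T v) = inner ℂ (S' u) (T' v)) (u v : E) :
    inner ℂ (S u) (T v) = inner ℂ (S' u) (T' v) := by
  have h1 : ∀ u ∈ s, ∀ v, inner ℂ (S u) (T v) = inner ℂ (S' u) (T' v) := fun u hu v =>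
    congrFun (Continuous.ext_on hs (f := fun v => inner ℂ (S u) (T v))
      (g := fun v => inner ℂ (S' u) (T' v)) (by fun_prop) (by fun_prop) fun v hv => h u hu v hv) v
  exact congrFun (Continuous.ext_on hs (f := fun u => inner ℂ (S u) (T v))
      (g := fun u => inner ℂ (S' u) (T' v)) (by fun_prop) (by fun_prop) fun u hu => h1 u hu v) u

/-- `(H + i)⁻¹ [iH, A] (H - i)⁻¹` in terms of the derivative of `exp (-itA) (H - i)⁻¹ exp (itA)`. -/
theorem inner_sandwich (hH : IsSelfAdjoint H) (hA : IsSelfAdjoint A)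
    (hC : IsC1 hA (resolventI hH)) {T : E →L[ℂ] E}
    (hT : ∀ x, HasDerivAt
      (fun t : ℝ => unitaryGroup hA (-t) (resolventI hH (unitaryGroup hA t x))) (T x) 0)
    (u v : E) : inner ℂ u (sandwich hH hA hC v) =
      -inner ℂ (u + (2 * Complex.I) • resolventI hH u) (T v) := by
  rw [← inner_neg_right]
  -- Both sides are continuous in `u` and `v`, so they may be taken in `dom A`, which `R` preserves.
  -- Formally `T = i[R, A] = -R [iH, A] R` and `W* R = (H + i)⁻¹`, whence `B = -W* T`.
  refine inner_eq_of_dense hA.dense_domain (S := 1)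
    (S' := 1 + (2 * Complex.I) • resolventI hH) (T' := -T) (fun u hu v hv => ?_) u v
  change inner ℂ u _ = inner ℂ (u + (2 * Complex.I) • resolventI hH u) (-T v)
  have ha := A.mem_graph ⟨_, hC.map_domain hA hu⟩
  have hb := A.mem_graph ⟨_, hC.map_domain hA hv⟩
  set a := A ⟨_, hC.map_domain hA hu⟩
  set b := A ⟨_, hC.map_domain hA hv⟩
  have h1 := (tendsto_const_nhds (x := u + (2 * Complex.I) • resolventI hH u)).inner
    (tendsto_commutator_groupQuotient hA hT v) (𝕜 := ℂ)
  have h2 := (tendsto_inner_groupQuotient hA ha v).sub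
    ((tendsto_const_nhds (x := u + (2 * Complex.I) • resolventI hH u)).inner
      (tendsto_quotient hA hb) (𝕜 := ℂ))
  -- With `G` the quotient, `⟨W u, R G v⟩ = ⟨R u, G v⟩`, so each half of the commutator converges
  -- separately.
  have h3 := tendsto_nhds_unique h1 (h2.congr fun t => by
    change _ = inner ℂ _ (resolventI hH (groupQuotient hA t v) -
      groupQuotient hA t (resolventI hH v))
    rw [inner_sub_right, inner_resolventI_right, groupQuotient_apply _ _ (resolventI hH v)])
  have h4 := graph_symm hA hb ha
  simp only at h4
  rw [inner_neg_right, h3, sandwich_of_mem_graph hH hA hC ha hb]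
  simp only [inner_add_left, inner_add_right, inner_smul_left, inner_smul_right, map_mul,
    Complex.conj_I, map_ofNat, h4]
  ring

/-- On `dom A` the explicit form is `i` times a skew-Hermitian expression; density and boundedness
do the rest. -/
theorem isSelfAdjoint_sandwich (hH : IsSelfAdjoint H) (hA : IsSelfAdjoint A)
    (hC : IsC1 hA (resolventI hH)) : IsSelfAdjoint (sandwich hH hA hC) := by
  rw [ContinuousLinearMap.isSelfAdjoint_iff_isSymmetric]
  intro u v
  refine inner_eq_of_dense hA.dense_domain (T := 1) (S' := 1) (fun u hu v hv => ?_) u v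
  change inner ℂ _ v = inner ℂ u _
  have ha := A.mem_graph ⟨_, hC.map_domain hA hu⟩
  have hb := A.mem_graph ⟨_, hC.map_domain hA hv⟩
  rw [← inner_conj_symm, sandwich_of_mem_graph hH hA hC ha hb,
    sandwich_of_mem_graph hH hA hC hb ha, map_mul, map_sub, inner_conj_symm, inner_conj_symm,
    Complex.conj_I]
  ring

/-! ### Elementary properties of the group `exp (i t H)`. -/

theorem unitaryGroup_resolventI (hH : IsSelfAdjoint H) (t : ℝ) (x : E) :
    unitaryGroup hH t (resolventI hH x) = resolventI hH (unitaryGroup hH t x) := by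
  have hR := resolventI_spec hH
  have h := hR.left_inv _ _ ((unitaryGroup_spec hH).map_graph (hR.graph x) t)
  rw [map_add, map_smul, add_sub_cancel_right] at h
  exact h.symm

theorem unitaryGroup_neg_apply (hH : IsSelfAdjoint H) (t : ℝ) (x : E) :
    unitaryGroup hH (-t) (unitaryGroup hH t x) = x := by
  change (unitaryGroup hH (-t) * unitaryGroup hH t) x = x
  rw [← (unitaryGroup_spec hH).add, neg_add_cancel, (unitaryGroup_spec hH).zero]; rfl

theorem unitaryGroup_add_apply (hH : IsSelfAdjoint H) (s t : ℝ) (x : E) :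
    unitaryGroup hH (s + t) x = unitaryGroup hH s (unitaryGroup hH t x) := by
  rw [(unitaryGroup_spec hH).add]; rfl

theorem norm_unitaryGroup_apply (hH : IsSelfAdjoint H) (t : ℝ) (x : E) :
    ‖unitaryGroup hH t x‖ = ‖x‖ :=
  ContinuousLinearMap.norm_map_of_mem_unitary ((unitaryGroup_spec hH).unitary t) x

/-- The group is only strongly continuous; the isometry property makes it jointly continuous in time
and vector. -/
theorem continuous_unitaryGroup_comp (hH : IsSelfAdjoint H) {X : Type*} [TopologicalSpace X]
    {c : X → ℝ} {f : X → E} (hc : Continuous c) (hf : Continuous f) :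
    Continuous fun x => unitaryGroup hH (c x) (f x) := by
  rw [continuous_iff_continuousAt]
  intro x
  have h : Tendsto (fun y => unitaryGroup hH (c y) (f y - f x)) (𝓝 x) (𝓝 0) := by
    rw [tendsto_zero_iff_norm_tendsto_zero]
    simp only [norm_unitaryGroup_apply]
    exact tendsto_iff_norm_sub_tendsto_zero.1 (hf.tendsto x)
  have h2 := h.add ((((unitaryGroup_spec hH).continuous (f x)).comp hc).tendsto x)
  rw [zero_add] at h2
  refine h2.congr fun y => ?_
  simp only [Function.comp_apply, map_sub, sub_add_cancel]

/-! ### The commutator identity integrated along the evolution. -/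

/-- Every `x` is allowed because `R` maps into `dom H`; the derivative is `-iHR` applied to the
evolved vector, with `HR = 1 + iR`. -/
theorem hasDerivAt_resolventI_unitaryGroup (hH : IsSelfAdjoint H) (x : E) (s : ℝ) :
    HasDerivAt (fun s : ℝ => resolventI hH (unitaryGroup hH (-s) x))
      (-(Complex.I • (unitaryGroup hH (-s) x +
        Complex.I • resolventI hH (unitaryGroup hH (-s) x)))) s := by
  have h := ((unitaryGroup_spec hH).hasDerivAt ((resolventI_spec hH).graph x) (-s)).scomp s
    (hasDerivAt_neg s)
  rw [map_add, map_smul, unitaryGroup_resolventI, neg_one_smul] at h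
  refine h.congr_of_eventuallyEq (Eventually.of_forall fun r => ?_)
  exact (unitaryGroup_resolventI hH (-r) x).symm

/-- The quotient is a bounded substitute for `iA`, so no domain condition on `x`, `y` arises. After
`HR = 1 + iR`, the terms of the product rule recombine into the commutator with `R`, paired with the
Cayley transform. -/
theorem hasDerivAt_inner_groupQuotient (hH : IsSelfAdjoint H) (hA : IsSelfAdjoint A)
    (ε : ℝ) (x y : E) (s : ℝ) :
    HasDerivAt (fun s : ℝ => inner ℂ (resolventI hH (unitaryGroup hH (-s) x))
        (groupQuotient hA ε (resolventI hH (unitaryGroup hH (-s) y))))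
      (-(Complex.I * inner ℂ (unitaryGroup hH (-s) x +
          (2 * Complex.I) • resolventI hH (unitaryGroup hH (-s) x))
        ((resolventI hH * groupQuotient hA ε - groupQuotient hA ε * resolventI hH)
          (unitaryGroup hH (-s) y)))) s := by
  have h := (hasDerivAt_resolventI_unitaryGroup hH x s).inner ℂ
    (((groupQuotient hA ε).restrictScalars ℝ).hasFDerivAt.comp_hasDerivAt s
      (hasDerivAt_resolventI_unitaryGroup hH y s))
  refine h.congr_deriv ?_
  change _ = -(Complex.I * inner ℂ _ (resolventI hH (groupQuotient hA ε (unitaryGroup hH (-s) y)) -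
    groupQuotient hA ε (resolventI hH (unitaryGroup hH (-s) y))))
  rw [inner_sub_right, inner_resolventI_right]
  simp only [Function.comp_apply, ContinuousLinearMap.coe_restrictScalars', map_neg, map_smul,
    map_add, inner_neg_left, inner_neg_right, inner_add_left, inner_add_right, inner_smul_left,
    inner_smul_right, map_mul, Complex.conj_I, map_ofNat]
  ring

/-- Integrated form of the commutator identity for `exp (i t H)` and `A`. -/
theorem integral_inner_sandwich (hH : IsSelfAdjoint H) (hA : IsSelfAdjoint A)
    (hC : IsC1 hA (resolventI hH)) {x y a b : E} (t : ℝ)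
    (ha : (resolventI hH (unitaryGroup hH (-t) x), a) ∈ A.graph)
    (hb : (resolventI hH y, b) ∈ A.graph) :
    ∫ s in (0 : ℝ)..t, inner ℂ (unitaryGroup hH (-s) x)
        (sandwich hH hA hC (unitaryGroup hH (-s) y)) =
      inner ℂ a (resolventI hH (unitaryGroup hH (-t) y)) - inner ℂ (resolventI hH x) b := by
  obtain ⟨T, hT⟩ := hC.exists_deriv
  -- A sequence of times is used because a convergent sequence is bounded, as Banach–Steinhaus
  -- requires. The resulting uniform bound on `K n` is the dominating constant below.
  let ε : ℕ → ℝ := fun n => 1 / ((n : ℝ) + 1)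
  have hε : Tendsto ε atTop (𝓝[≠] 0) :=
    tendsto_nhdsWithin_iff.2 ⟨tendsto_one_div_add_atTop_nhds_zero_nat,
      Eventually.of_forall fun n => by simp only [ε, Set.mem_compl_iff, Set.mem_singleton_iff]
                                       positivity⟩
  let K : ℕ → E →L[ℂ] E := fun n =>
    resolventI hH * groupQuotient hA (ε n) - groupQuotient hA (ε n) * resolventI hH
  have hK : ∀ v, Tendsto (fun n => K n v) atTop (𝓝 (T v)) := fun v =>
    (tendsto_commutator_groupQuotient hA hT v).comp hε
  obtain ⟨M, hM⟩ := banach_steinhaus (g := K) fun v => by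
    obtain ⟨C, hC⟩ := (hK v).norm.bddAbove_range
    exact ⟨C, fun n => hC ⟨n, rfl⟩⟩
  let W : E →L[ℂ] E := 1 + (2 * Complex.I) • resolventI hH
  have hW : ∀ u, u + (2 * Complex.I) • resolventI hH u = W u := fun u => rfl
  have hUc : ∀ z, Continuous fun s : ℝ => unitaryGroup hH (-s) z := fun z =>
    continuous_unitaryGroup_comp hH continuous_neg continuous_const
  have hcont : ∀ S S' : E →L[ℂ] E, Continuous fun s : ℝ =>
      inner ℂ (S (unitaryGroup hH (-s) x)) (S' (unitaryGroup hH (-s) y)) := fun S S' =>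
    (S.continuous.comp (hUc x)).inner (S'.continuous.comp (hUc y))
  have hint : ∀ n, ∫ s in (0 : ℝ)..t, -(Complex.I * inner ℂ (W (unitaryGroup hH (-s) x))
      (K n (unitaryGroup hH (-s) y))) =
      inner ℂ (resolventI hH (unitaryGroup hH (-t) x))
        (groupQuotient hA (ε n) (resolventI hH (unitaryGroup hH (-t) y))) -
      inner ℂ (resolventI hH x) (groupQuotient hA (ε n) (resolventI hH y)) := by
    intro n
    refine (intervalIntegral.integral_eq_sub_of_hasDerivAt
      (fun s _ => hasDerivAt_inner_groupQuotient hH hA (ε n) x y s)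
      ((continuous_const.mul (hcont W (K n))).neg.intervalIntegrable _ _)).trans ?_
    simp only [neg_zero, (unitaryGroup_spec hH).zero]
    rfl
  have hlim : Tendsto (fun n => ∫ s in (0 : ℝ)..t,
      -(Complex.I * inner ℂ (W (unitaryGroup hH (-s) x)) (K n (unitaryGroup hH (-s) y)))) atTop
      (𝓝 (∫ s in (0 : ℝ)..t,
        -(Complex.I * inner ℂ (W (unitaryGroup hH (-s) x)) (T (unitaryGroup hH (-s) y))))) := by
    refine intervalIntegral.tendsto_integral_filter_of_dominated_convergence
      (fun _ => (‖W‖ * ‖x‖) * (M * ‖y‖))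
      (Eventually.of_forall fun n =>
        (continuous_const.mul (hcont W (K n))).neg.aestronglyMeasurable)
      (Eventually.of_forall fun n => Eventually.of_forall fun s _ => ?_)
      intervalIntegrable_const (Eventually.of_forall fun s _ => ?_)
    · rw [norm_neg, norm_mul, Complex.norm_I, one_mul]
      refine (norm_inner_le_norm _ _).trans (mul_le_mul ?_ ?_ (norm_nonneg _) (by positivity))
      · refine (W.le_opNorm _).trans ?_
        rw [norm_unitaryGroup_apply]
      · refine ((K n).le_of_opNorm_le (hM n) _).trans ?_
        rw [norm_unitaryGroup_apply]
    · exact ((tendsto_const_nhds.inner (hK _)).const_mul _).neg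
  -- The two endpoints need different domain conditions. At `s = t` the quotient is moved to the
  -- left vector, at `s = 0` it acts on the right one. Hence the asymmetry between `ha` and `hb`.
  have h1 := (tendsto_inner_groupQuotient hA ha
      (resolventI hH (unitaryGroup hH (-t) y))).comp hε |>.sub
    (((tendsto_const_nhds (x := resolventI hH x)).inner (tendsto_quotient hA hb) (𝕜 := ℂ)).comp hε)
  have h2 := tendsto_nhds_unique hlim (h1.congr fun n => (hint n).symm)
  have h3 : ∀ s, -(Complex.I * inner ℂ (W (unitaryGroup hH (-s) x))
      (T (unitaryGroup hH (-s) y))) = Complex.I * inner ℂ (unitaryGroup hH (-s) x)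
        (sandwich hH hA hC (unitaryGroup hH (-s) y)) := fun s => by
    rw [inner_sandwich hH hA hC hT, hW, mul_neg]
  simp only [h3] at h2
  rw [intervalIntegral.integral_const_mul, inner_smul_right, ← mul_sub] at h2
  exact mul_left_cancel₀ Complex.I_ne_zero h2

/-! ### Time averages: symmetry of the limit and its commutation with the group. -/

theorem continuous_conj_unitaryGroup (hH : IsSelfAdjoint H) (B : E →L[ℂ] E) (x : E) :
    Continuous fun s : ℝ => unitaryGroup hH s (B (unitaryGroup hH (-s) x)) :=
  continuous_unitaryGroup_comp hH continuous_id
    (B.continuous.comp (continuous_unitaryGroup_comp hH continuous_neg continuous_const))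

theorem inner_timeAverage (hH : IsSelfAdjoint H) (hA : IsSelfAdjoint A)
    (hC : IsC1 hA (resolventI hH)) (t : ℝ) (x y : E) :
    inner ℂ x (timeAverage hH hA hC t y) = (t : ℂ)⁻¹ * ∫ s in (0 : ℝ)..t,
      inner ℂ (unitaryGroup hH (-s) x) (sandwich hH hA hC (unitaryGroup hH (-s) y)) := by
  have h1 : ∀ s, inner ℂ (unitaryGroup hH (-s) x) (sandwich hH hA hC (unitaryGroup hH (-s) y)) =
      innerSL ℂ x (unitaryGroup hH s (sandwich hH hA hC (unitaryGroup hH (-s) y))) := fun s => by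
    rw [(unitaryGroup_spec hH).inner_left, neg_neg]; rfl
  simp only [h1]
  rw [ContinuousLinearMap.intervalIntegral_comp_comm _
    ((continuous_conj_unitaryGroup hH _ y).intervalIntegrable _ _), timeAverage,
    ← Complex.coe_smul, inner_smul_right, Complex.ofReal_inv]
  rfl

theorem isSelfAdjoint_of_tendsto_timeAverage (hH : IsSelfAdjoint H) (hA : IsSelfAdjoint A)
    (hC : IsC1 hA (resolventI hH)) {D : E →L[ℂ] E}
    (hD : ∀ φ : E, Tendsto (fun t : ℝ => timeAverage hH hA hC t φ) atTop (𝓝 (D φ))) :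
    IsSelfAdjoint D := by
  rw [ContinuousLinearMap.isSelfAdjoint_iff_isSymmetric]
  intro x y
  refine tendsto_nhds_unique ((hD x).inner (tendsto_const_nhds (x := y)) (𝕜 := ℂ))
    (((tendsto_const_nhds (x := x)).inner (hD y) (𝕜 := ℂ)).congr fun t => ?_)
  have hB := (ContinuousLinearMap.isSelfAdjoint_iff_isSymmetric).1
    (isSelfAdjoint_sandwich hH hA hC)
  -- An interval integral is a real sign times a set integral, and complex conjugation passes
  -- through the latter.
  rw [← inner_conj_symm _ y, inner_timeAverage, inner_timeAverage, map_mul, map_inv₀,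
    Complex.conj_ofReal, intervalIntegral.intervalIntegral_eq_integral_uIoc,
    intervalIntegral.intervalIntegral_eq_integral_uIoc, Complex.real_smul, Complex.real_smul,
    map_mul, Complex.conj_ofReal, ← integral_conj]
  congr 3
  funext s
  rw [inner_conj_symm]
  exact (hB _ _).symm

/-- Both vectors average the same function `g`, over the windows `[0, t]` and `[-r, t - r]`. The
integrals differ by two end pieces of length `|r|`, on which `‖g‖ ≤ ‖B‖ ‖x‖`; this is the source of
the factor 2. -/
theorem norm_unitaryGroup_timeAverage_sub_le (hH : IsSelfAdjoint H) (hA : IsSelfAdjoint A)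
    (hC : IsC1 hA (resolventI hH)) (r : ℝ) {t : ℝ} (ht : 0 < t) (x : E) :
    ‖unitaryGroup hH r (timeAverage hH hA hC t x) -
      timeAverage hH hA hC t (unitaryGroup hH r x)‖ ≤
        2 * (‖sandwich hH hA hC‖ * ‖x‖ * |r|) / t := by
  let B := sandwich hH hA hC
  let g : ℝ → E := fun s => unitaryGroup hH (s + r) (B (unitaryGroup hH (-s) x))
  have hg : Continuous g := continuous_unitaryGroup_comp hH (by fun_prop)
    (B.continuous.comp (continuous_unitaryGroup_comp hH continuous_neg continuous_const))
  have hgn : ∀ s, ‖g s‖ ≤ ‖B‖ * ‖x‖ := fun s => by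
    simp only [g]
    rw [norm_unitaryGroup_apply, ← norm_unitaryGroup_apply hH (-s) x]
    exact B.le_opNorm _
  have h1 : unitaryGroup hH r (timeAverage hH hA hC t x) = t⁻¹ • ∫ s in (0 : ℝ)..t, g s := by
    rw [timeAverage, ← Complex.coe_smul, map_smul, Complex.coe_smul,
      ← ContinuousLinearMap.intervalIntegral_comp_comm _
        ((continuous_conj_unitaryGroup hH _ x).intervalIntegrable _ _)]
    simp only [g, add_comm _ r, unitaryGroup_add_apply]
    rfl
  have h2 : timeAverage hH hA hC t (unitaryGroup hH r x) =
      t⁻¹ • ∫ s in (-r)..(t - r), g s := by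
    rw [timeAverage]
    congr 1
    have := intervalIntegral.integral_comp_sub_right (a := 0) (b := t) g r
    rw [zero_sub] at this
    rw [← this]
    congr 1
    funext s
    simp only [g]
    rw [← unitaryGroup_add_apply, sub_add_cancel, neg_sub, neg_add_eq_sub]
  have hi : ∀ p q, IntervalIntegrable g MeasureTheory.volume p q := fun p q =>
    hg.intervalIntegrable p q
  have h3 : (∫ s in (0 : ℝ)..t, g s) - ∫ s in (-r)..(t - r), g s =
      (∫ s in (0 : ℝ)..(-r), g s) - ∫ s in t..(t - r), g s := by
    rw [intervalIntegral.integral_interval_sub_interval_comm (hi _ _) (hi _ _) (hi _ _)]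
  rw [h1, h2, ← smul_sub, h3, norm_smul, norm_inv, Real.norm_of_nonneg ht.le, inv_mul_eq_div]
  gcongr
  have h4 := intervalIntegral.norm_integral_le_of_norm_le_const (a := 0) (b := -r)
    (fun s _ => hgn s)
  have h5 := intervalIntegral.norm_integral_le_of_norm_le_const (a := t) (b := t - r)
    (fun s _ => hgn s)
  rw [sub_zero, abs_neg] at h4
  rw [sub_sub_cancel_left, abs_neg] at h5
  refine (norm_sub_le _ _).trans ?_
  change _ ≤ 2 * (‖B‖ * ‖x‖ * |r|)
  linarith

theorem unitaryGroup_comm_of_tendsto_timeAverage (hH : IsSelfAdjoint H) (hA : IsSelfAdjoint A)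
    (hC : IsC1 hA (resolventI hH)) {D : E →L[ℂ] E}
    (hD : ∀ φ : E, Tendsto (fun t : ℝ => timeAverage hH hA hC t φ) atTop (𝓝 (D φ)))
    (r : ℝ) (x : E) : unitaryGroup hH r (D x) = D (unitaryGroup hH r x) := by
  have h1 := (((unitaryGroup hH r).continuous.tendsto _).comp (hD x)).sub
    (hD (unitaryGroup hH r x))
  have h2 : Tendsto (fun t : ℝ => 2 * (‖sandwich hH hA hC‖ * ‖x‖ * |r|) / t) atTop (𝓝 0) :=
    tendsto_const_nhds.div_atTop tendsto_id
  refine sub_eq_zero.1 (tendsto_nhds_unique h1 (squeeze_zero_norm' ?_ h2))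
  filter_upwards [eventually_gt_atTop 0] with t ht
  exact norm_unitaryGroup_timeAverage_sub_le hH hA hC r ht x

/-! ### Decay of matrix elements. -/

theorem tendsto_inner_unitaryGroup_map (hH : IsSelfAdjoint H) (hA : IsSelfAdjoint A)
    (hC : IsC1 hA (resolventI hH)) {D : E →L[ℂ] E}
    (hD : ∀ φ : E, Tendsto (fun t : ℝ => timeAverage hH hA hC t φ) atTop (𝓝 (D φ)))
    {x y : E} (hx : x ∈ A.domain) (hy : y ∈ A.domain) :
    Tendsto (fun t : ℝ => inner ℂ x (unitaryGroup hH (-t) (D y))) atTop (𝓝 0) := by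
  have ha := A.mem_graph ⟨_, hC.map_domain hA hx⟩
  have hb := A.mem_graph ⟨_, hC.map_domain hA hy⟩
  set a := A ⟨_, hC.map_domain hA hx⟩
  set b := A ⟨_, hC.map_domain hA hy⟩
  have hR : ∀ z, ‖resolventI hH z‖ ≤ ‖z‖ := fun z => by
    simpa using (resolventI_spec hH).norm_le hH z
  -- The moving vector `U t x` has constant norm, so strong convergence of the averages suffices.
  have h1 : Tendsto (fun t : ℝ => inner ℂ (unitaryGroup hH t x)
      (D y - timeAverage hH hA hC t y)) atTop (𝓝 0) := by
    have h := ((tendsto_const_nhds (x := D y)).sub (hD y)).norm.const_mul ‖x‖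
    rw [sub_self, norm_zero, mul_zero] at h
    refine squeeze_zero_norm (fun t => ?_) h
    refine (norm_inner_le_norm _ _).trans_eq ?_
    rw [norm_unitaryGroup_apply]
  have h2 : Tendsto (fun t : ℝ => inner ℂ (unitaryGroup hH t x)
      (timeAverage hH hA hC t y)) atTop (𝓝 0) := by
    have h : Tendsto (fun t : ℝ => (‖a‖ * ‖y‖ + ‖x‖ * ‖b‖) / t) atTop (𝓝 0) :=
      tendsto_const_nhds.div_atTop tendsto_id
    refine squeeze_zero_norm' ?_ h
    filter_upwards [eventually_gt_atTop 0] with t ht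
    -- The integrated identity is applied to `U t x`. Its endpoint vector at `s = t` is then `R x`,
    -- so `a` does not depend on `t` and the boundary terms stay bounded.
    rw [inner_timeAverage, integral_inner_sandwich hH hA hC t
      (by rw [unitaryGroup_neg_apply]; exact ha) hb, norm_mul, norm_inv, Complex.norm_real,
      Real.norm_of_nonneg ht.le, inv_mul_eq_div]
    gcongr
    refine (norm_sub_le _ _).trans (add_le_add ?_ ?_) <;>
      refine (norm_inner_le_norm _ _).trans ?_ <;> gcongr
    · exact (hR _).trans_eq (norm_unitaryGroup_apply _ _ _)
    · exact (hR _).trans_eq (norm_unitaryGroup_apply _ _ _)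
  have h3 := h1.add h2
  rw [add_zero] at h3
  refine h3.congr fun t => ?_
  rw [← inner_add_right, sub_add_cancel, (unitaryGroup_spec hH).inner_left]

/-- Mixing, tested on dense sets. -/
theorem tendsto_inner_unitaryGroup_of_mem_closure (hH : IsSelfAdjoint H) {s s' : Set E}
    (h : ∀ x ∈ s, ∀ y ∈ s',
      Tendsto (fun t : ℝ => inner ℂ x (unitaryGroup hH (-t) y)) atTop (𝓝 0))
    {x y : E} (hx : x ∈ closure s) (hy : y ∈ closure s') :
    Tendsto (fun t : ℝ => inner ℂ x (unitaryGroup hH (-t) y)) atTop (𝓝 0) := by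
  -- The right vector is approximated with `x ∈ s` fixed, then the left one. The errors are uniform
  -- in `t` by isometry, and the `+ 1` in the tolerances covers zero vectors.
  have h1 : ∀ x ∈ s, Tendsto (fun t : ℝ => inner ℂ x (unitaryGroup hH (-t) y)) atTop (𝓝 0) := by
    intro x hx
    rw [Metric.tendsto_nhds]
    intro ε hε
    obtain ⟨y', hy', hyy⟩ := Metric.mem_closure_iff.1 hy (ε / (2 * (‖x‖ + 1))) (by positivity)
    filter_upwards [Metric.tendsto_nhds.1 (h x hx y' hy') (ε / 2) (by positivity)] with t ht
    rw [dist_eq_norm, lt_div_iff₀ (by positivity)] at hyy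
    rw [dist_zero_right] at ht ⊢
    have h2 : inner ℂ x (unitaryGroup hH (-t) y) = inner ℂ x (unitaryGroup hH (-t) (y - y')) +
        inner ℂ x (unitaryGroup hH (-t) y') := by
      rw [← inner_add_right, ← map_add, sub_add_cancel]
    have h3 := norm_inner_le_norm (𝕜 := ℂ) x (unitaryGroup hH (-t) (y - y'))
    rw [norm_unitaryGroup_apply] at h3
    have h4 := norm_add_le (inner ℂ x (unitaryGroup hH (-t) (y - y')))
      (inner ℂ x (unitaryGroup hH (-t) y'))
    rw [← h2] at h4
    nlinarith [norm_nonneg (y - y'), norm_nonneg x]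
  rw [Metric.tendsto_nhds]
  intro ε hε
  obtain ⟨x', hx', hxx⟩ := Metric.mem_closure_iff.1 hx (ε / (2 * (‖y‖ + 1))) (by positivity)
  filter_upwards [Metric.tendsto_nhds.1 (h1 x' hx') (ε / 2) (by positivity)] with t ht
  rw [dist_eq_norm, lt_div_iff₀ (by positivity)] at hxx
  rw [dist_zero_right] at ht ⊢
  have h2 : inner ℂ x (unitaryGroup hH (-t) y) = inner ℂ (x - x') (unitaryGroup hH (-t) y) +
      inner ℂ x' (unitaryGroup hH (-t) y) := by
    rw [← inner_add_left, sub_add_cancel]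
  have h3 := norm_inner_le_norm (𝕜 := ℂ) (x - x') (unitaryGroup hH (-t) y)
  rw [norm_unitaryGroup_apply] at h3
  have h4 := norm_add_le (inner ℂ (x - x') (unitaryGroup hH (-t) y))
    (inner ℂ x' (unitaryGroup hH (-t) y))
  rw [← h2] at h4
  nlinarith [norm_nonneg (x - x'), norm_nonneg y]

/-- For self-adjoint `D`, `(ker D)ᗮ` is the closure of the range, and by continuity a dense set has
dense image in the range. -/
theorem ker_orthogonal_le_closure (D : E →L[ℂ] E) (hD : IsSelfAdjoint D) {s : Set E}
    (hs : Dense s) : ((LinearMap.ker D.toLinearMap)ᗮ : Set E) ⊆ closure (D '' s) := by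
  have h := D.orthogonal_ker
  rw [hD.adjoint_eq] at h
  rw [show ((LinearMap.ker D.toLinearMap)ᗮ : Set E) =
    ((LinearMap.range D.toLinearMap).topologicalClosure : Set E) from congrArg _ h,
    Submodule.topologicalClosure_coe]
  refine closure_minimal ?_ isClosed_closure
  rintro _ ⟨x, rfl⟩
  exact image_closure_subset_closure_image D.continuous ⟨x, hs x, rfl⟩

/-! ### Reducing subspaces and the part of `H` in them. -/

/-- A closed subspace whose orthogonal projection commutes with the group reduces the generator. -/
theorem reduces_of_commute (hH : IsSelfAdjoint H) (K : Submodule ℂ E) [K.HasOrthogonalProjection]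
    (h : ∀ t x, unitaryGroup hH t (K.starProjection x) =
      K.starProjection (unitaryGroup hH t x)) : Reduces K H := by
  intro x y hxy
  have hU := unitaryGroup_spec hH
  rw [hU.generator]
  have h2 := (K.starProjection.restrictScalars ℝ).hasFDerivAt.comp_hasDerivAt (0 : ℝ)
    ((hU.generator x y).1 hxy)
  rw [ContinuousLinearMap.coe_restrictScalars', map_smul] at h2
  exact h2.congr_of_eventuallyEq (Eventually.of_forall fun s => h s x)

/-- Invariance is assumed for all real times and `U t` has adjoint `U (-t)`, so `Kᗮ` is invariant
too and `U t` respects the decomposition of `x`. -/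
theorem starProjection_comm_of_invariant (hH : IsSelfAdjoint H) (K : Submodule ℂ E)
    [Kᗮ.HasOrthogonalProjection] [CompleteSpace K]
    (h : ∀ t, ∀ x ∈ K, unitaryGroup hH t x ∈ K) (t : ℝ) (x : E) :
    unitaryGroup hH t (Kᗮ.starProjection x) = Kᗮ.starProjection (unitaryGroup hH t x) := by
  refine (Submodule.eq_starProjection_of_mem_orthogonal (K := Kᗮ) ?_ ?_).symm
  · rw [Submodule.mem_orthogonal]
    intro u hu
    have h1 := (unitaryGroup_spec hH).inner_left (-t) u (Kᗮ.starProjection x)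
    rw [neg_neg] at h1
    rw [← h1]
    exact (Submodule.mem_orthogonal _ _).1 (Submodule.starProjection_apply_mem _ _) _ (h _ _ hu)
  · rw [← map_sub]
    have h2 : x - Kᗮ.starProjection x ∈ K := by
      have := Submodule.sub_starProjection_mem_orthogonal (K := Kᗮ) x
      rwa [Submodule.orthogonal_orthogonal] at this
    rw [Submodule.orthogonal_orthogonal]
    exact h _ _ h2

theorem isSelfAdjoint_part (hH : IsSelfAdjoint H) (K : Submodule ℂ E) [CompleteSpace K]
    (h : Reduces K H) : IsSelfAdjoint (part H K) := by
  have hp : ∀ {a b : E}, (a, b) ∈ H.graph →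
      (K.orthogonalProjectionOnto a, K.orthogonalProjectionOnto b) ∈ (part H K).graph := fun hab =>
    mem_part_graph.2 (h _ _ hab)
  -- The projection of `dom H` is dense in `K` and, by reduction, lies in the domain of the part.
  have hd : Dense ((part H K).domain : Set K) := by
    intro x
    have h1 : K.orthogonalProjectionOnto (x : E) ∈ closure (K.orthogonalProjectionOnto '' H.domain) :=
      image_closure_subset_closure_image K.orthogonalProjectionOnto.continuous
        ⟨x, hH.dense_domain x, rfl⟩
    rw [Submodule.orthogonalProjectionOnto_mem_subspace_eq_self] at h1
    refine closure_mono ?_ h1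
    rintro _ ⟨a, ha, rfl⟩
    exact LinearPMap.mem_domain_of_mem_graph (hp (H.mem_graph ⟨a, ha⟩))
  rw [LinearPMap.isSelfAdjoint_def]
  refine LinearPMap.eq_of_eq_graph ?_
  rw [LinearPMap.adjoint_graph_eq_graph_adjoint hd]
  ext ⟨x, y⟩
  rw [mem_part_graph, mem_graph_iff_forall hH, Submodule.mem_adjoint_iff]
  constructor
  -- Since `x` and `y` lie in `K`, testing against a pair of the graph of `H` is the same as testing
  -- against its projection, which belongs to the part.
  · intro hxy a b hab
    have h1 := sub_eq_zero.1 (hxy _ _ (hp hab))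
    simpa using h1
  · intro hxy a b hab
    exact sub_eq_zero.2 (hxy _ _ (mem_part_graph.1 hab))

/-! ### Absence of eigenvectors. -/

/-- Matrix elements of the group on an eigenvector have constant modulus. -/
theorem norm_inner_unitaryGroup_of_eigenvector (hH : IsSelfAdjoint H) {x : E} {μ : ℂ}
    (hx : (x, μ • x) ∈ H.graph) (t : ℝ) : ‖inner ℂ x (unitaryGroup hH t x)‖ = ‖x‖ ^ 2 := by
  rcases eq_or_ne x 0 with rfl | hx0
  · simp
  have hμ : starRingEnd ℂ μ = μ := by
    have h := graph_symm hH hx hx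
    rw [inner_smul_left, inner_smul_right] at h
    exact mul_right_cancel₀ (inner_self_ne_zero.2 hx0) h
  -- Removing the expected phase leaves a function with zero derivative; the phase has modulus one
  -- because `μ` is real.
  have hd : ∀ s : ℝ, HasDerivAt (fun s : ℝ => Complex.exp (-(Complex.I * μ * s)) *
      inner ℂ x (unitaryGroup hH s x)) 0 s := by
    intro s
    have h1 := (hasDerivAt_const s x).inner ℂ ((unitaryGroup_spec hH).hasDerivAt hx s)
    have h2 : HasDerivAt (fun s : ℝ => Complex.exp (-(Complex.I * μ * s)))
        (Complex.exp (-(Complex.I * μ * s)) * -(Complex.I * μ * 1)) s :=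
      (((hasDerivAt_id (s : ℂ)).const_mul (Complex.I * μ)).neg.cexp).comp_ofReal
    refine (h2.mul h1).congr_deriv ?_
    rw [map_smul, inner_smul_right, inner_smul_right, inner_zero_left]
    ring
  have h4 := is_const_of_deriv_eq_zero (fun s => (hd s).differentiableAt)
    (fun s => (hd s).deriv) t 0
  simp only [Complex.ofReal_zero, mul_zero, neg_zero, Complex.exp_zero, one_mul,
    (unitaryGroup_spec hH).zero] at h4
  have h5 : ‖Complex.exp (-(Complex.I * μ * t))‖ = 1 := by
    rw [Complex.norm_exp]
    have : μ.im = 0 := Complex.conj_eq_iff_im.1 hμ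
    simp [this]
  have h6 := congrArg norm h4
  rw [norm_mul, h5, one_mul] at h6
  rw [h6]
  change ‖inner ℂ x x‖ = _
  rw [inner_self_eq_norm_sq_to_K]
  simp

/-- An eigenvector of the part is one of `H`, so its diagonal matrix element has constant modulus
`‖x‖ ^ 2` and also tends to zero. The spanning set is thus `{0}`, zero being admitted in its
definition. -/
theorem hasPurelyContinuousSpectrum_part (hH : IsSelfAdjoint H) (K : Submodule ℂ E)
    (h : ∀ x ∈ K, Tendsto (fun t : ℝ => inner ℂ x (unitaryGroup hH (-t) x)) atTop (𝓝 0)) :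
    HasPurelyContinuousSpectrum (part H K) := by
  have h0 : Submodule.span ℂ {x : K | ∃ μ : ℂ, (x, μ • x) ∈ (part H K).graph} = ⊥ := by
    rw [Submodule.span_eq_bot]
    rintro x ⟨μ, hx⟩
    have h1 := (h x x.2).norm
    simp only [norm_inner_unitaryGroup_of_eigenvector hH (mem_part_graph.1 hx), norm_zero] at h1
    have h2 := tendsto_nhds_unique h1 tendsto_const_nhds
    exact Subtype.ext (by simpa using h2.symm)
  rw [HasPurelyContinuousSpectrum, pointSubspace, Submodule.orthogonal_closure, h0,
    Submodule.bot_orthogonal_eq_top]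

end CommutatorMixing

theorem theorem4p1 {E : Type*} [NormedAddCommGroup E] [InnerProductSpace ℂ E] [CompleteSpace E]
    (H A : E →ₗ.[ℂ] E) (hH : IsSelfAdjoint H) (hA : IsSelfAdjoint A)
    (hC : CommutatorMixing.IsC1 hA (CommutatorMixing.resolventI hH))
    (D : E →L[ℂ] E)
    (hD : ∀ φ : E, Tendsto (fun t : ℝ => CommutatorMixing.timeAverage hH hA hC t φ) atTop (𝓝 (D φ)))
    (hη : ∀ η : ℝ → ℝ, ContDiff ℝ (⊤ : ℕ∞) η → HasCompactSupport η → (0 : ℝ) ∉ tsupport η →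
      ∀ φ ∈ A.domain, cfc (fun r : ℝ => r⁻¹ * η r) D φ ∈ A.domain) :
    (∀ φ : E, ∀ ψ ∈ (LinearMap.ker D.toLinearMap)ᗮ,
      Tendsto (fun t : ℝ => inner ℂ φ (CommutatorMixing.unitaryGroup hH (-t) ψ)) atTop (𝓝 0)) ∧
    CommutatorMixing.Reduces (LinearMap.ker D.toLinearMap)ᗮ H ∧
    IsSelfAdjoint (CommutatorMixing.part H (LinearMap.ker D.toLinearMap)ᗮ) ∧
    CommutatorMixing.HasPurelyContinuousSpectrum
      (CommutatorMixing.part H (LinearMap.ker D.toLinearMap)ᗮ) := by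
  have hsa := CommutatorMixing.isSelfAdjoint_of_tendsto_timeAverage hH hA hC hD
  have hmix : ∀ φ : E, ∀ ψ ∈ (LinearMap.ker D.toLinearMap)ᗮ,
      Tendsto (fun t : ℝ => inner ℂ φ (CommutatorMixing.unitaryGroup hH (-t) ψ)) atTop (𝓝 0) := by
    intro φ ψ hψ
    refine CommutatorMixing.tendsto_inner_unitaryGroup_of_mem_closure hH
      (s := A.domain) (s' := D '' A.domain) ?_ (hA.dense_domain φ)
      (CommutatorMixing.ker_orthogonal_le_closure D hsa hA.dense_domain hψ)
    rintro x hx _ ⟨y, hy, rfl⟩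
    exact CommutatorMixing.tendsto_inner_unitaryGroup_map hH hA hC hD hx hy
  have hcl : CompleteSpace (LinearMap.ker D.toLinearMap) := D.isClosed_ker.completeSpace_coe
  have hred : CommutatorMixing.Reduces (LinearMap.ker D.toLinearMap)ᗮ H := by
    -- Commutation of `D` with the group makes `ker D` invariant, and its orthogonal complement
    -- inherits this.
    refine CommutatorMixing.reduces_of_commute hH _
      (CommutatorMixing.starProjection_comm_of_invariant hH _ fun t x hx => ?_)
    have hx' : D x = 0 := hx
    change D (CommutatorMixing.unitaryGroup hH t x) = 0
    rw [← CommutatorMixing.unitaryGroup_comm_of_tendsto_timeAverage hH hA hC hD, hx', map_zero]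
  exact ⟨hmix, hred, CommutatorMixing.isSelfAdjoint_part hH _ hred,
    CommutatorMixing.hasPurelyContinuousSpectrum_part hH _ fun x hx => hmix x x hx⟩
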